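/- **Setting.** Let $(M,\omega)$ be a symplectic $4$-manifold and $F=(f_1,f_2):M\to\mathbb{R}^2$ an almost-toric system, i.e. $F$ is smooth, $\{f_1,f_2\}=0$, $dF$ is onto almost everywhere, the fibers of $F$ are compact, and all singular points of $F$ are non-degenerate without hyperbolic blocks. Suppose that $(M,\omega,F)$ is a *neighborhood of a focus-focus fiber of multiplicity one*: all fibers of $F$ are connected, there is exactly one singular fiber $F^{-1}(c_0)$, and it contains exactly one focus-focus point $p_0$. Let $\omega_{\mathrm{can}}=dx_1\wedge dy_1+dx_2\wedge dy_2$ on $\mathbb{R}^4$ and $q=(x_1y_2-x_2y_1,\;x_1y_1+x_2y_2)$. *Eliasson isomorphisms and normalized neighborhoods.* An Eliasson isomorphism for $(M,\omega,F)$ is a pair $(\varphi,g)$ consisting of a symplectomorphism $\varphi:(U,\omega)\to(V,\omega_{\mathrm{can}})$ between open neighborhoods $U\ni p_0$ in $M$ and $V\ni 0$ in $\mathbb{R}^4$, and a diffeomorphism $g:F(U)\to q(V)$ with $g(c_0)=0$, such that $g\circ F=q\circ\varphi$ on $U$. The normalized neighborhood built from it is the system $F'=g\circ F$ on $M'=F^{-1}(F(U))$,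 together with $\varphi$. *Regularized action.* For $c\in F'(M')\setminus\{0\}$, let $\Sigma_c\subset T_c^*\mathbb{R}^2$ be the period lattice of $(M',\omega,F')$: the set of covectors $\alpha$ for which the time-$2\pi$ flow of the Hamiltonian vector field of $\alpha\circ F'$ fixes a point of $F'^{-1}(c)$. Let $(a,b)$ be the coordinates of $\mathbb{R}^2$, $w=a+ib$, $l=\{a=0,\ b\ge 0\}$, and let $\mathrm{Log}$ be the branch of the logarithm on $\mathbb{C}\setminus l$ with argument in $(-\tfrac{3\pi}{2},\tfrac{\pi}{2})$. The regularized action of the normalized neighborhood is the (germ at $0$ of the) smooth function $\mathsf{h}$ defined near $0\in\mathbb{R}^2$ such that, off $l$, $$\Sigma=\mathbb{Z}\Big\langle da,\ \tfrac{1}{2\pi}\,\mathrm{Im}\,d\,(w\,\mathrm{Log}\,w-w)+d\mathsf{h}\Big\rangle,\qquad \mathsf{h}(0,0)=0,\qquad \frac{\partial\mathsf{h}}{\partial a}(0,0)\in[0,1).$$ *Taylor series orbits.* Let $\mathbb{R}[[a,b]]_{\mathrm{ff}}=\mathbb{R}[[a,b]]/(\mathbb{R}\oplus\mathbb{Z}a)$,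 let $[\mathsf{h}]^\infty$ be the class in it of the Taylor series of $\mathsf{h}$ at the origin, and let $K_4=\mathbb{Z}/2\times\mathbb{Z}/2$ act on it by $$T\star(j_1,j_2)=\epsilon_2\,T(\epsilon_1 a,\epsilon_2 b)+\frac{j_1a}{2},\qquad \epsilon_k=(-1)^{j_k}.$$ Write $\mathcal{O}(T)$ for the $K_4$-orbit of $T$. **Theorem.** Let $(\varphi_1,g_1)$ and $(\varphi_2,g_2)$ be two Eliasson isomorphisms for $(M,\omega,F)$, and let $\mathsf{h}_1$, $\mathsf{h}_2$ be the regularized actions of the normalized neighborhoods built from them. Then $$\mathcal{O}\big([\mathsf{h}_1]^\infty\big)=\mathcal{O}\big([\mathsf{h}_2]^\infty\big).$$ -/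

import Mathlib

open scoped Manifold ContDiff Topology
open Set

namespace FocusFocus

/-! ### Symplectic geometry of 4-manifolds -/

/-- The model space `ℝ⁴` with coordinates `(x₁, y₁, x₂, y₂)`. -/
abbrev E4 : Type := EuclideanSpace ℝ (Fin 4)

section Manifold

variable {M : Type*} [TopologicalSpace M] [ChartedSpace E4 M]

/-- The expression in the chart around `p₀` of a (not necessarily continuous) 2-form on `M`. -/
noncomputable def chartForm (form : ∀ p : M, TangentSpace (𝓡 4) p [⋀^Fin 2]→L[ℝ] ℝ) (p₀ : M)
    (x : E4) : E4 [⋀^Fin 2]→L[ℝ] ℝ :=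
  (form ((extChartAt (𝓡 4) p₀).symm x)).compContinuousLinearMap
    (mfderiv 𝓘(ℝ, E4) (𝓡 4) (extChartAt (𝓡 4) p₀).symm x)

variable (M) in
/-- A symplectic form on the 4-manifold `M`: a smooth, closed, nondegenerate 2-form. -/
structure SymplecticForm where
  form : ∀ p : M, TangentSpace (𝓡 4) p [⋀^Fin 2]→L[ℝ] ℝ
  smooth : ∀ p₀ : M, ContDiffOn ℝ ∞ (chartForm form p₀) (extChartAt (𝓡 4) p₀).target
  closed : ∀ p₀ : M, ∀ x ∈ (extChartAt (𝓡 4) p₀).target, extDeriv (chartForm form p₀) x = 0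
  nondegenerate : ∀ (p : M) (u : TangentSpace (𝓡 4) p), (∀ v, form p ![u, v] = 0) → u = 0

namespace SymplecticForm

variable (Ω : SymplecticForm M)

theorem exists_unique_dual (p : M) (β : TangentSpace (𝓡 4) p →L[ℝ] ℝ) :
    ∃! X : TangentSpace (𝓡 4) p, ∀ v, Ω.form p ![X, v] = - β v := by
  let f : E4 [⋀^Fin 2]→L[ℝ] ℝ := Ω.form p
  let L : E4 →ₗ[ℝ] (E4 →ₗ[ℝ] ℝ) := LinearMap.mk₂ ℝ (fun u v : E4 => f ![u, v])
    (fun u u' v => by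
      have h (x y : E4) : Function.update ![x, v] 0 y = ![y, v] := by
        ext i; fin_cases i <;> simp
      simpa only [h] using f.map_update_add ![u, v] 0 u u')
    (fun c u v => by
      have h (x y : E4) : Function.update ![x, v] 0 y = ![y, v] := by
        ext i; fin_cases i <;> simp
      simpa only [h] using f.map_update_smul ![u, v] 0 c u)
    (fun u v v' => by
      have h (x y : E4) : Function.update ![u, x] 1 y = ![u, y] := by
        ext i; fin_cases i <;> simp
      simpa only [h] using f.map_update_add ![u, v] 1 v v')
    (fun c u v => by
      have h (x y : E4) : Function.update ![u, x] 1 y = ![u, y] := by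
        ext i; fin_cases i <;> simp
      simpa only [h] using f.map_update_smul ![u, v] 1 c v)
  have hinj : Function.Injective L := by
    rw [← LinearMap.ker_eq_bot, LinearMap.ker_eq_bot']
    intro u hu
    exact Ω.nondegenerate p u fun v => LinearMap.congr_fun hu v
  have hsurj : Function.Surjective L :=
    (LinearMap.injective_iff_surjective_of_finrank_eq_finrank
      (Subspace.dual_finrank_eq (K := ℝ) (V := E4)).symm).1 hinj
  let b : E4 →ₗ[ℝ] ℝ := - (β : TangentSpace (𝓡 4) p →ₗ[ℝ] ℝ)
  obtain ⟨X, hX⟩ := hsurj b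
  refine ⟨X, fun v => LinearMap.congr_fun hX v, fun Y hY => hinj ?_⟩
  rw [hX]
  exact LinearMap.ext fun v => hY v

/-- The Hamiltonian vector field `X_f` of `f`, defined by `ω(X_f, ·) = - df`. -/
noncomputable def hamField (f : M → ℝ) (p : M) : TangentSpace (𝓡 4) p :=
  (Ω.exists_unique_dual p (mfderiv (𝓡 4) 𝓘(ℝ, ℝ) f p)).choose

theorem hamField_spec (f : M → ℝ) (p : M) (v : TangentSpace (𝓡 4) p) :
    Ω.form p ![Ω.hamField f p, v] = - (mfderiv (𝓡 4) 𝓘(ℝ, ℝ) f p : E4 →L[ℝ] ℝ) v :=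
  (Ω.exists_unique_dual p (mfderiv (𝓡 4) 𝓘(ℝ, ℝ) f p)).choose_spec.1 v

/-- The Poisson bracket `{f, g} = ω(X_f, X_g)`. -/
noncomputable def poisson (f g : M → ℝ) (p : M) : ℝ :=
  Ω.form p ![Ω.hamField f p, Ω.hamField g p]

end SymplecticForm

/-! ### Integrable systems with two degrees of freedom -/

/-- The differential of `F : M → ℝ²` at `p`. -/
noncomputable def dF (F : M → ℝ × ℝ) (p : M) : TangentSpace (𝓡 4) p →L[ℝ] ℝ × ℝ :=
  mfderiv (𝓡 4) 𝓘(ℝ, ℝ × ℝ) F p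

/-- A point is singular if the differential of `F` does not have maximal rank there. -/
def IsSingularPoint (F : M → ℝ × ℝ) (p : M) : Prop := ¬ Function.Surjective (dF F p)

/-- `(M, ω, F)` is an integrable system: `F` is smooth, its components Poisson commute, and
`F` is a submersion at almost every point (the singular points form a null set in each chart). -/
structure IsIntegrableSystem (Ω : SymplecticForm M) (F : M → ℝ × ℝ) : Prop where
  smooth : ContMDiff (𝓡 4) 𝓘(ℝ, ℝ × ℝ) ∞ F
  involution : ∀ p, Ω.poisson (fun x => (F x).1) (fun x => (F x).2) p = 0
  independent : ∀ p₀ : M, MeasureTheory.volume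
    {x ∈ (extChartAt (𝓡 4) p₀).target | IsSingularPoint F ((extChartAt (𝓡 4) p₀).symm x)} = 0

/-- The second derivative of `f` at `p` in the direction `v`, computed in the chart around `p`
with respect to which `TangentSpace (𝓡 4) p` is identified with `ℝ⁴`. It is used only where
`df` vanishes at `p`, so that it is the (coordinate independent) Hessian quadratic form of `f`. -/
noncomputable def hessian {G : Type*} [NormedAddCommGroup G] [NormedSpace ℝ G]
    (f : M → G) (p : M) (v : TangentSpace (𝓡 4) p) : G :=
  fderiv ℝ (fun x : E4 => fderiv ℝ (f ∘ (extChartAt (𝓡 4) p).symm) x (v : E4))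
    (extChartAt (𝓡 4) p p) (v : E4)

/-- The canonical symplectic form `dx₁ ∧ dy₁ + dx₂ ∧ dy₂` on `ℝ⁴`. -/
def omegaCan (u v : E4) : ℝ := (u 0 * v 1 - u 1 * v 0) + (u 2 * v 3 - u 3 * v 2)

/-- The focus-focus model `q = (x₁ y₂ - x₂ y₁, x₁ y₁ + x₂ y₂)`. -/
def qFF (u : E4) : ℝ × ℝ := (u 0 * u 3 - u 2 * u 1, u 0 * u 1 + u 2 * u 3)

/-- The elliptic-elliptic model `q = ((x₁² + y₁²)/2, (x₂² + y₂²)/2)`. -/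
noncomputable def qEE (u : E4) : ℝ × ℝ := ((u 0 ^ 2 + u 1 ^ 2) / 2, (u 2 ^ 2 + u 3 ^ 2) / 2)

/-- `p` is a fixed point (rank `0`) and, in suitable linear symplectic coordinates on `T_p M`, the
Hessians at `p` of the components of `F` span the space spanned by the two components of the
quadratic model `q`. -/
def HasQuadraticModel (q : E4 → ℝ × ℝ) (Ω : SymplecticForm M) (F : M → ℝ × ℝ) (p : M) : Prop :=
  dF F p = 0 ∧
  ∃ (S : E4 ≃ₗ[ℝ] TangentSpace (𝓡 4) p) (B : (ℝ × ℝ) ≃ₗ[ℝ] (ℝ × ℝ)),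
    (∀ u v, Ω.form p ![S u, S v] = omegaCan u v) ∧ ∀ u, hessian F p (S u) = B (q u)

/-- Nondegenerate singular points of focus-focus type (Williamson type `(0,0,0,1)`). -/
def IsFocusFocusPoint (Ω : SymplecticForm M) (F : M → ℝ × ℝ) (p : M) : Prop :=
  HasQuadraticModel qFF Ω F p

/-- Nondegenerate singular points of elliptic-elliptic type (Williamson type `(0,2,0,0)`). -/
def IsEllipticEllipticPoint (Ω : SymplecticForm M) (F : M → ℝ × ℝ) (p : M) : Prop :=
  HasQuadraticModel qEE Ω F p

/-- Nondegenerate singular points of elliptic-regular type (Williamson type `(1,1,0,0)`): `dF` has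
rank one at `p`, and a nontrivial combination `f` of the components of `F` that is critical at `p`
has a Hessian that is definite on the two-dimensional reduced space `(T_p O)^ω / T_p O`, where
`T_p O` is the tangent space to the orbit, so that `(T_p O)^ω = ker dF_p`. -/
def IsEllipticRegularPoint (Ω : SymplecticForm M) (F : M → ℝ × ℝ) (p : M) : Prop :=
  Module.finrank ℝ (LinearMap.range (dF F p : TangentSpace (𝓡 4) p →ₗ[ℝ] ℝ × ℝ)) = 1 ∧
  ∃ α : ℝ × ℝ →L[ℝ] ℝ, α ≠ 0 ∧ (∀ v, α (dF F p v) = 0) ∧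
    ∀ v, dF F p v = 0 → (∀ β : ℝ × ℝ →L[ℝ] ℝ, v ≠ Ω.hamField (fun x => β (F x)) p) →
      hessian (fun x => α (F x)) p v ≠ 0

/-- Almost-toric systems: integrable systems with two degrees of freedom and compact fibers, all of
whose singular points are nondegenerate without hyperbolic blocks. -/
structure IsAlmostToric (Ω : SymplecticForm M) (F : M → ℝ × ℝ) : Prop
    extends IsIntegrableSystem Ω F where
  compact_fiber : ∀ c, IsCompact (F ⁻¹' {c})
  nondegenerate : ∀ p, IsSingularPoint F p →
    IsFocusFocusPoint Ω F p ∨ IsEllipticEllipticPoint Ω F p ∨ IsEllipticRegularPoint Ω F p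

/-- `(M, ω, F)` is a neighborhood of a focus-focus fiber of multiplicity one, with focus-focus
point `p₀` and focus-focus value `F p₀`. -/
structure IsFocusFocusNeighborhood (Ω : SymplecticForm M) (F : M → ℝ × ℝ) (p₀ : M) : Prop
    extends IsAlmostToric Ω F where
  connected_fiber : ∀ p, IsConnected (F ⁻¹' {F p})
  focusFocus : IsFocusFocusPoint Ω F p₀
  only_singular_fiber : ∀ p, IsSingularPoint F p → F p = F p₀
  multiplicity_one : ∀ p, F p = F p₀ → IsFocusFocusPoint Ω F p → p = p₀

/-! ### Eliasson isomorphisms and the bundle of periods -/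

/-- An Eliasson isomorphism `(φ, g)`: a symplectomorphism `φ : U → V` from an open neighborhood
`U` of the focus-focus point `p₀` onto an open neighborhood `V` of the origin in `ℝ⁴`, and a
diffeomorphism `g : F(U) → q(V)` with `g(F(p₀)) = 0`, such that `g ∘ F = q ∘ φ` on `U`. -/
structure EliassonIso (Ω : SymplecticForm M) (F : M → ℝ × ℝ) (p₀ : M) where
  φ : OpenPartialHomeomorph M E4
  g : OpenPartialHomeomorph (ℝ × ℝ) (ℝ × ℝ)
  mem_source : p₀ ∈ φ.source
  zero_mem_target : (0 : E4) ∈ φ.target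
  φ_smooth : ContMDiffOn (𝓡 4) 𝓘(ℝ, E4) ∞ φ φ.source
  φ_symm_smooth : ContMDiffOn 𝓘(ℝ, E4) (𝓡 4) ∞ φ.symm φ.target
  φ_symplectic : ∀ p ∈ φ.source, ∀ u v : TangentSpace (𝓡 4) p,
    omegaCan (mfderiv (𝓡 4) 𝓘(ℝ, E4) φ p u) (mfderiv (𝓡 4) 𝓘(ℝ, E4) φ p v) = Ω.form p ![u, v]
  g_source : g.source = F '' φ.source
  g_target : g.target = qFF '' φ.target
  g_smooth : ContDiffOn ℝ ∞ g g.source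
  g_symm_smooth : ContDiffOn ℝ ∞ g.symm g.target
  g_value : g (F p₀) = 0
  comm : ∀ p ∈ φ.source, g (F p) = qFF (φ p)

/-- The fiber at `c` of the bundle of periods of the system `F'` on the open subset `D` of `M`:
the covectors `α` at `c` such that `φ_α^{2π}` fixes a point of the fiber over `c`. On this fiber the
vector field attached to `α` is the Hamiltonian vector field of `α ∘ F'`. -/
def periodLattice (Ω : SymplecticForm M) (D : Set M) (F' : M → ℝ × ℝ) (c : ℝ × ℝ) :
    Set (ℝ × ℝ →L[ℝ] ℝ) :=
  {α | ∃ γ : ℝ → M, IsMIntegralCurve (I := 𝓡 4) γ (Ω.hamField (fun p => α (F' p))) ∧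
    (∀ t, γ t ∈ D) ∧ F' (γ 0) = c ∧ γ (2 * Real.pi) = γ 0}

end Manifold

/-- The half-line `l = {a = 0, b ≥ 0}`. -/
def slit : Set (ℝ × ℝ) := {c | c.1 = 0 ∧ 0 ≤ c.2}

/-- The branch of the complex logarithm on `ℂ ∖ l` with argument in `(-3π/2, π/2)`. -/
noncomputable def branchLog (w : ℂ) : ℂ :=
  Complex.log (Complex.I * w) - (Real.pi / 2 : ℝ) * Complex.I

/-- The function `(1/2π) Im (w Log w - w)` of `w = a + i b`. -/
noncomputable def logAction (c : ℝ × ℝ) : ℝ :=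
  let w : ℂ := ⟨c.1, c.2⟩
  (1 / (2 * Real.pi)) * (w * branchLog w - w).im

section Regularized

variable {M : Type*} [TopologicalSpace M] [ChartedSpace E4 M]

/-- `h` is a regularized action of the system `F'` on the open subset `D` of `M`, with focus-focus
value `0`, over some open neighborhood `W` of the origin: `h` is smooth on `W`, over `W ∖ l` the
bundle of periods is `ℤ⟨da, (1/2π) Im d(w Log w - w) + dh⟩`, and `h` is normalized by `h(0) = 0` and
`∂h/∂a (0) ∈ [0,1)`. -/
def IsRegularizedActionOn (Ω : SymplecticForm M) (D : Set M) (F' : M → ℝ × ℝ)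
    (h : ℝ × ℝ → ℝ) : Prop :=
  ∃ W : Set (ℝ × ℝ), IsOpen W ∧ (0 : ℝ × ℝ) ∈ W ∧ W ⊆ F' '' D ∧ ContDiffOn ℝ ∞ h W ∧
    (∀ c ∈ W \ slit, periodLattice Ω D F' c =
      (Submodule.span ℤ {ContinuousLinearMap.fst ℝ ℝ ℝ, fderiv ℝ logAction c + fderiv ℝ h c} :
        Set (ℝ × ℝ →L[ℝ] ℝ))) ∧
    h 0 = 0 ∧ fderiv ℝ h 0 (1, 0) ∈ Ico (0 : ℝ) 1

namespace EliassonIso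

variable {Ω : SymplecticForm M} {F : M → ℝ × ℝ} {p₀ : M} (E : EliassonIso Ω F p₀)

/-- The total space `F⁻¹(F(U))` of the normalized neighborhood built from `(φ, g)`. -/
def normalizedDomain : Set M := F ⁻¹' (F '' E.φ.source)

/-- The moment map `g ∘ F` of the normalized neighborhood built from `(φ, g)`. -/
def normalizedMap : M → ℝ × ℝ := fun p => E.g (F p)

/-- `h` is the regularized action of the normalized neighborhood
`((F⁻¹(F(U)), ω, g ∘ F), φ)` built from `(φ, g)`. -/
def IsRegularizedAction (h : ℝ × ℝ → ℝ) : Prop :=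
  IsRegularizedActionOn Ω E.normalizedDomain E.normalizedMap h

end EliassonIso

end Regularized

/-! ### Taylor series and the action of `K₄` -/

/-- Formal power series in the variables `a` (index `0`) and `b` (index `1`). -/
abbrev Series : Type := MvPowerSeries (Fin 2) ℝ

/-- The Taylor series at the origin of a function that is smooth near the origin of `ℝ²`. -/
noncomputable def taylorSeries (h : ℝ × ℝ → ℝ) : Series := fun n =>
  ((fun f : ℝ × ℝ → ℝ => fun x => fderiv ℝ f x (1, 0))^[n 0]
    ((fun f : ℝ × ℝ → ℝ => fun x => fderiv ℝ f x (0, 1))^[n 1] h)) 0 /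
    ((n 0).factorial * (n 1).factorial : ℝ)

/-- The subgroup `ℝ ⊕ ℤ a` of `ℝ⟦a, b⟧`. -/
noncomputable def ffSubgroup : AddSubgroup Series where
  carrier := {T | ∃ (r : ℝ) (k : ℤ),
    T = MvPowerSeries.C r + MvPowerSeries.C (k : ℝ) * MvPowerSeries.X 0}
  zero_mem' := ⟨0, 0, by simp⟩
  add_mem' := by
    rintro _ _ ⟨r, k, rfl⟩ ⟨r', k', rfl⟩
    exact ⟨r + r', k + k', by push_cast; simp only [map_add]; ring⟩
  neg_mem' := by
    rintro _ ⟨r, k, rfl⟩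
    exact ⟨-r, -k, by push_cast; simp only [map_neg]; ring⟩

/-- `ℝ⟦a, b⟧_ff = ℝ⟦a, b⟧ / (ℝ ⊕ ℤ a)`. -/
abbrev SeriesFF : Type := Series ⧸ ffSubgroup

/-- The class in `ℝ⟦a, b⟧_ff` of the Taylor series of `h` at the origin. -/
noncomputable def taylorClass (h : ℝ × ℝ → ℝ) : SeriesFF := QuotientAddGroup.mk (taylorSeries h)

/-- The group `K₄ = ℤ/2 × ℤ/2`, written additively. -/
abbrev K4 : Type := ZMod 2 × ZMod 2

/-- The isomorphism `ℤ/2 ≅ {1, -1}`, with integer values. -/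
def sgn (k : ZMod 2) : ℤ := if k = 0 then 1 else -1

theorem sgn_add (k l : ZMod 2) : sgn (k + l) = sgn k * sgn l := by
  revert k l; decide

/-- The additive map `T ↦ ε₂ T(ε₁ a, ε₂ b)`, where `εᵢ` is the sign of `jᵢ`. -/
noncomputable def signHom (j : K4) : Series →+ Series :=
  (AddMonoidHom.mulLeft (MvPowerSeries.C (sgn j.2 : ℝ))).comp
    (MvPowerSeries.rescale ![(sgn j.1 : ℝ), (sgn j.2 : ℝ)]).toAddMonoidHom

theorem signHom_apply (j : K4) (T : Series) : signHom j T =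
    MvPowerSeries.C (sgn j.2 : ℝ) * MvPowerSeries.rescale ![(sgn j.1 : ℝ), (sgn j.2 : ℝ)] T := rfl

theorem coeff_signHom (j : K4) (T : Series) (n : Fin 2 →₀ ℕ) :
    MvPowerSeries.coeff n (signHom j T) =
      sgn j.2 * ((sgn j.1 : ℝ) ^ n 0 * (sgn j.2 : ℝ) ^ n 1) * MvPowerSeries.coeff n T := by
  rw [signHom_apply, MvPowerSeries.coeff_C_mul, MvPowerSeries.coeff_rescale, Finsupp.prod_fintype _ _
    (by simp)]
  simp [Fin.prod_univ_two, mul_assoc]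

theorem signHom_C (j : K4) (r : ℝ) :
    signHom j (MvPowerSeries.C r) = MvPowerSeries.C (sgn j.2 * r) := by
  ext n
  rw [coeff_signHom, MvPowerSeries.coeff_C, MvPowerSeries.coeff_C]
  split_ifs with h
  · simp [h]
  · simp

theorem signHom_C_mul_X (j : K4) (r : ℝ) :
    signHom j (MvPowerSeries.C r * MvPowerSeries.X 0) =
      MvPowerSeries.C (sgn j.1 * sgn j.2 * r) * MvPowerSeries.X 0 := by
  ext n
  rw [coeff_signHom, MvPowerSeries.coeff_C_mul, MvPowerSeries.coeff_C_mul, MvPowerSeries.coeff_X]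
  split_ifs with h
  · have h0 : n 0 = 1 := by simp [h]
    have h1 : n 1 = 0 := by simp [h]
    rw [h0, h1]; ring
  · simp

theorem signHom_mem (j : K4) : ffSubgroup ≤ ffSubgroup.comap (signHom j) := by
  rintro _ ⟨r, k, rfl⟩
  refine ⟨sgn j.2 * r, sgn j.1 * sgn j.2 * k, ?_⟩
  rw [map_add, signHom_C, signHom_C_mul_X]
  push_cast
  rfl

theorem signHom_zero (T : Series) : signHom 0 T = T := by
  ext n; simp [coeff_signHom, sgn]

theorem signHom_add (j k : K4) (T : Series) : signHom (j + k) T = signHom j (signHom k T) := by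
  ext n
  simp only [coeff_signHom, Prod.fst_add, Prod.snd_add, sgn_add]
  push_cast
  ring

/-- The right action `T ⋆ (j₁, j₂) = ε₂ T(ε₁ a, ε₂ b) + j₁ a / 2` of the abelian group `K₄` on
`ℝ⟦a, b⟧_ff`, where `εᵢ` is the sign of `jᵢ`. -/
noncomputable def star (T : SeriesFF) (j : K4) : SeriesFF :=
  QuotientAddGroup.map ffSubgroup ffSubgroup (signHom j) (signHom_mem j) T +
    QuotientAddGroup.mk (MvPowerSeries.C ((j.1.val : ℝ) / 2) * MvPowerSeries.X 0)

theorem star_mk (T : Series) (j : K4) : star (QuotientAddGroup.mk T) j =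
    QuotientAddGroup.mk
      (signHom j T + MvPowerSeries.C ((j.1.val : ℝ) / 2) * MvPowerSeries.X 0) := rfl

theorem exists_int_half (j k : K4) : ∃ m : ℤ, (sgn j.1 * sgn j.2 * ((k.1.val : ℝ) / 2) +
    (j.1.val : ℝ) / 2) = ((j + k).1.val : ℝ) / 2 + m := by
  obtain ⟨m, hm⟩ : ∃ m : ℤ, sgn j.1 * sgn j.2 * (k.1.val : ℤ) + (j.1.val : ℤ) =
      ((j + k).1.val : ℤ) + 2 * m := by
    have : (2 : ℤ) ∣ sgn j.1 * sgn j.2 * (k.1.val : ℤ) + (j.1.val : ℤ) - ((j + k).1.val : ℤ) := by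
      revert j k; decide
    obtain ⟨m, hm⟩ := this
    exact ⟨m, by linarith⟩
  refine ⟨m, ?_⟩
  have : (sgn j.1 * sgn j.2 * (k.1.val : ℝ) + (j.1.val : ℝ)) = ((j + k).1.val : ℝ) + 2 * m := by
    exact_mod_cast hm
  linarith

noncomputable instance : AddAction K4 SeriesFF where
  vadd j T := star T j
  zero_vadd T := by
    induction T using QuotientAddGroup.induction_on with
    | H T =>
      change star _ _ = _
      rw [star_mk, signHom_zero]
      simp
  add_vadd j k T := by
    induction T using QuotientAddGroup.induction_on with
    | H T =>
      change star _ _ = star (star _ _) _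
      rw [star_mk, star_mk, star_mk, map_add, signHom_add, signHom_C_mul_X, QuotientAddGroup.eq]
      obtain ⟨m, hm⟩ := exists_int_half j k
      refine ⟨0, m, ?_⟩
      rw [map_zero, add_assoc (signHom j (signHom k T)), ← add_mul, ← map_add, hm, map_add]
      ring

/-- The `K₄`-orbit `𝓞(T)` of `T`. -/
noncomputable def orbit (T : SeriesFF) : Set SeriesFF := AddAction.orbit K4 T

theorem orbit_eq (T : SeriesFF) : orbit T = Set.range fun j : K4 => star T j := rfl

end FocusFocus

/-! The transition map `G = E₂.g ∘ E₁.g.symm` is a germ of diffeomorphism of the plane fixing the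
origin. The period lattice depends only on the system over the base, so `G` pulls the lattice of
`h₂` back to that of `h₁` (`EliassonIso.isLatticeMap`). The rest of the argument takes place in the
plane.

Rigidity of the first component: the `∂/∂b` component of the second generator is `log |w| / 2π` plus
a bounded term, so near the origin a period covector with bounded `∂/∂b` component is an integer
multiple of `da`. Applied to `G` and to its inverse, this gives `G^* da = e da` with `e = ±1`, hence
`G = (e a, G₂)` (`exists_fst_eq`). On the half-plane `a > 0` the second generator is then pulled
back to `s` times itself plus `k da`, with constant integers `s = ±1` and `k`. Integration yields
`(logAction + h₂) ∘ G = s (logAction + h₁) + k a + C` (`exists_action_eq`).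

Rigidity of the second component: along a ray `r (1, t)` write `G = r (e, g r)`. Since `logAction`
is homogeneous of degree one up to a multiple of `b log r`, the identity becomes `r (g r - s t) log
r =` a function with an expansion in powers of `r`. Powers of `r` and powers times `log r` are
asymptotically independent, so `g r - s t` is flat (`isFlat_of_mul_log`), and `G` is `(e a, s b)` to
infinite order along the ray. Substituting back, `s h₁(r, rt) - h₂(e r, s r t)` is affine in `r` up
to a flat error (`isFlat_ray`). Letting `t` vary recovers all Taylor coefficients. The signs `(e,
s)` are the element of `K₄`, and the jump of the argument between `a > 0` and `a < 0` produces the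
term `a / 2`. -/

namespace FocusFocus

open Filter Asymptotics


/-! ### Period lattices under a change of coordinates on the base -/

section Lattice

variable {M : Type*} [TopologicalSpace M] [ChartedSpace E4 M] {Ω : SymplecticForm M}
  {F : M → ℝ × ℝ} {p₀ : M}

/-- The Hamiltonian vector field at a point depends only on the differential at that point. -/
theorem SymplecticForm.hamField_congr {f f' : M → ℝ} {p : M}
    (h : (mfderiv (𝓡 4) 𝓘(ℝ, ℝ) f p : E4 →L[ℝ] ℝ) = (mfderiv (𝓡 4) 𝓘(ℝ, ℝ) f' p : E4 →L[ℝ] ℝ)) :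
    Ω.hamField f p = Ω.hamField f' p := by
  refine (Ω.exists_unique_dual p (mfderiv (𝓡 4) 𝓘(ℝ, ℝ) f' p)).unique (fun v => ?_)
    (fun v => Ω.hamField_spec f' p v)
  rw [Ω.hamField_spec f p v]
  exact congrArg (fun L : E4 →L[ℝ] ℝ => -L v) h

theorem mfderiv_comp_integrable (hF : ContMDiff (𝓡 4) 𝓘(ℝ, ℝ × ℝ) ∞ F) {G : Type*}
    [NormedAddCommGroup G] [NormedSpace ℝ G] {k : ℝ × ℝ → G} {p : M}
    (hk : DifferentiableAt ℝ k (F p)) :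
    (mfderiv (𝓡 4) 𝓘(ℝ, G) (fun x => k (F x)) p : E4 →L[ℝ] G) = (fderiv ℝ k (F p)).comp (dF F p) := by
  have h1 : HasMFDerivAt (𝓡 4) 𝓘(ℝ, ℝ × ℝ) F p (dF F p) :=
    ((hF p).mdifferentiableAt (by simp)).hasMFDerivAt
  have h2 : HasMFDerivAt 𝓘(ℝ, ℝ × ℝ) 𝓘(ℝ, G) k (F p) (fderiv ℝ k (F p)) :=
    hk.hasFDerivAt.hasMFDerivAt
  exact (h2.comp p h1).mfderiv

theorem SymplecticForm.form_swap (Ω : SymplecticForm M) (p : M) (u v : TangentSpace (𝓡 4) p) :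
    Ω.form p ![u, v] = - Ω.form p ![v, u] := by
  have h := (Ω.form p).toAlternatingMap.map_swap ![v, u] (i := 0) (j := 1) (by simp)
  have e : ![v, u] ∘ Equiv.swap (0 : Fin 2) 1 = ![u, v] := by
    ext i; fin_cases i <;> simp
  rw [e] at h
  exact h

theorem SymplecticForm.form_self (Ω : SymplecticForm M) (p : M) (u : TangentSpace (𝓡 4) p) :
    Ω.form p ![u, u] = 0 := by
  have := Ω.form_swap p u u
  linarith

/-- The Hamiltonian vector fields of functions of `F` are tangent to the fibers of `F`. -/
theorem IsIntegrableSystem.dF_hamField (hF : IsIntegrableSystem Ω F) (β : ℝ × ℝ →L[ℝ] ℝ) (p : M) :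
    dF F p (Ω.hamField (fun x => β (F x)) p) = 0 := by
  have key (α β : ℝ × ℝ →L[ℝ] ℝ) (p : M) (v : TangentSpace (𝓡 4) p) :
      Ω.form p ![Ω.hamField (fun x => α (F x)) p, v] = - α (dF F p v) := by
    rw [Ω.hamField_spec, mfderiv_comp_integrable hF.smooth α.differentiableAt, α.fderiv]
    rfl
  set X1 := Ω.hamField (fun x => (F x).1) p with hX1
  set X2 := Ω.hamField (fun x => (F x).2) p with hX2
  set X := Ω.hamField (fun x => β (F x)) p with hX
  have k1 (v) : Ω.form p ![X1, v] = - (dF F p v).1 := key (ContinuousLinearMap.fst ℝ ℝ ℝ) β p v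
  have k2 (v) : Ω.form p ![X2, v] = - (dF F p v).2 := key (ContinuousLinearMap.snd ℝ ℝ ℝ) β p v
  have k (v) : Ω.form p ![X, v] = - β (dF F p v) := key β β p v
  have h12 : Ω.form p ![X1, X2] = 0 := hF.involution p
  have d1 : dF F p X1 = 0 := by
    refine Prod.ext ?_ ?_
    · have := k1 X1; rw [Ω.form_self] at this; simpa using this
    · have := k2 X1; rw [Ω.form_swap, h12] at this; simpa using this
  have d2 : dF F p X2 = 0 := by
    refine Prod.ext ?_ ?_
    · have := k1 X2; rw [h12] at this; simpa using this
    · have := k2 X2; rw [Ω.form_self] at this; simpa using this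
  refine Prod.ext ?_ ?_
  · have := k1 X; rw [Ω.form_swap, k, d1] at this; simpa using this
  · have := k2 X; rw [Ω.form_swap, k, d2] at this; simpa using this

/-- Curves tangent to the fibers of `F` stay in one fiber. -/
theorem eq_of_tangent (hF : ContMDiff (𝓡 4) 𝓘(ℝ, ℝ × ℝ) ∞ F) {γ : ℝ → M}
    {X : ∀ p : M, TangentSpace (𝓡 4) p} (hγ : IsMIntegralCurve (I := 𝓡 4) γ X)
    (hX : ∀ t, dF F (γ t) (X (γ t)) = 0) (t : ℝ) : F (γ t) = F (γ 0) := by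
  have h (t : ℝ) : HasFDerivAt (F ∘ γ) (0 : ℝ →L[ℝ] ℝ × ℝ) t := by
    have h1 : HasMFDerivAt (𝓡 4) 𝓘(ℝ, ℝ × ℝ) F (γ t) (dF F (γ t)) :=
      ((hF (γ t)).mdifferentiableAt (by simp)).hasMFDerivAt
    have h2 := (h1.comp t (hγ t)).hasFDerivAt
    have e : (dF F (γ t) : E4 →L[ℝ] ℝ × ℝ).comp
        ((1 : ℝ →L[ℝ] ℝ).smulRight (X (γ t) : E4)) = 0 := by
      ext1
      simpa using hX t
    exact e ▸ h2
  exact is_const_of_fderiv_eq_zero (𝕜 := ℝ) (fun t => (h t).differentiableAt) (fun t => (h t).fderiv) t 0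

/-- The period lattice of the normalized neighborhood is the pullback by `g⁻¹` of the period
lattice of `(M, ω, F)`. -/
theorem EliassonIso.mem_periodLattice_iff (hF : IsIntegrableSystem Ω F) (E : EliassonIso Ω F p₀)
    {c : ℝ × ℝ} (hc : c ∈ E.g.source) (α : ℝ × ℝ →L[ℝ] ℝ) :
    α ∈ periodLattice Ω E.normalizedDomain E.normalizedMap (E.g c) ↔
      α.comp (fderiv ℝ E.g c) ∈ periodLattice Ω univ F c := by
  have hD (p : M) : p ∈ E.normalizedDomain ↔ F p ∈ E.g.source := by
    rw [E.g_source]; rfl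
  have hdiff {c} (hc : c ∈ E.g.source) : DifferentiableAt ℝ E.g c :=
    (E.g_smooth.contDiffAt (E.g.open_source.mem_nhds hc)).differentiableAt (by simp)
  have hham (p : M) (hp : F p ∈ E.g.source) :
      Ω.hamField (fun x => α (E.normalizedMap x)) p =
        Ω.hamField (fun x => α.comp (fderiv ℝ E.g (F p)) (F x)) p := by
    apply SymplecticForm.hamField_congr
    refine (mfderiv_comp_integrable (k := fun y => α (E.g y)) hF.smooth
      (α.differentiableAt.comp _ (hdiff hp))).trans ?_
    refine Eq.trans ?_ (mfderiv_comp_integrable (k := α.comp (fderiv ℝ E.g (F p))) hF.smooth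
      (ContinuousLinearMap.differentiableAt _)).symm
    rw [ContinuousLinearMap.fderiv]
    congr 1
    exact (α.hasFDerivAt.comp _ (hdiff hp).hasFDerivAt).fderiv
  constructor
  · rintro ⟨γ, hγ, hγD, h0, hper⟩
    have hs (t : ℝ) : F (γ t) ∈ E.g.source := (hD _).1 (hγD t)
    have h0' : F (γ 0) = c := E.g.injOn (hs 0) hc h0
    -- The curve never leaves the fiber over `c`, so the covector `α ∘ dg` at `F (γ t)` can be
    -- frozen at `c`. The same curve is therefore an integral curve for the linear function `α.comp
    -- (fderiv ℝ E.g c)` of `F`.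
    have hconst (t : ℝ) : F (γ t) = c := by
      rw [← h0']
      refine eq_of_tangent hF.smooth hγ (fun t => ?_) t
      rw [hham _ (hs t)]
      exact hF.dF_hamField _ _
    refine ⟨γ, fun t => ?_, fun _ => mem_univ _, h0', hper⟩
    have e := hham (γ t) (hs t)
    rw [hconst t] at e
    have := hγ t
    rw [e] at this
    exact this
  · rintro ⟨γ, hγ, -, h0, hper⟩
    have hconst (t : ℝ) : F (γ t) = c := by
      rw [← h0]
      exact eq_of_tangent hF.smooth hγ (fun t => hF.dF_hamField _ _) t
    refine ⟨γ, fun t => ?_, fun t => (hD _).2 (by rw [hconst t]; exact hc),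
      by simp [normalizedMap, h0], hper⟩
    have e := hham (γ t) (by rw [hconst t]; exact hc)
    rw [hconst t] at e
    rw [e]
    exact hγ t

end Lattice


/-! ### Flat functions and asymptotic expansions as `r → 0⁺` -/

/-- `f` is `O(rⁿ)` for all `n` as `r → 0⁺`. -/
def IsFlat (f : ℝ → ℝ) : Prop := ∀ n : ℕ, f =O[𝓝[>] 0] fun r => r ^ n

/-- `f` has an asymptotic expansion in nonnegative powers of `r` as `r → 0⁺`. -/
def HasPowerExpansion (f : ℝ → ℝ) : Prop :=
  ∀ n : ℕ, ∃ p : Polynomial ℝ, (fun r => f r - p.eval r) =O[𝓝[>] 0] fun r => r ^ n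

theorem polynomial_isBigO_one (p : Polynomial ℝ) :
    (fun r => p.eval r) =O[𝓝[>] 0] fun _ : ℝ => (1 : ℝ) :=
  ((p.continuous.tendsto 0).mono_left nhdsWithin_le_nhds).isBigO_one ℝ

theorem HasPowerExpansion.isBigO_one {f : ℝ → ℝ} (hf : HasPowerExpansion f) :
    f =O[𝓝[>] 0] fun _ : ℝ => (1 : ℝ) := by
  obtain ⟨p, hp⟩ := hf 0
  simp only [pow_zero] at hp
  exact (hp.add (polynomial_isBigO_one p)).congr_left fun r => by ring

theorem HasPowerExpansion.add {f g : ℝ → ℝ} (hf : HasPowerExpansion f)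
    (hg : HasPowerExpansion g) : HasPowerExpansion fun r => f r + g r := fun n => by
  obtain ⟨p, hp⟩ := hf n
  obtain ⟨q, hq⟩ := hg n
  refine ⟨p + q, (hp.add hq).congr_left fun r => ?_⟩
  simp; ring

theorem HasPowerExpansion.mul {f g : ℝ → ℝ} (hf : HasPowerExpansion f)
    (hg : HasPowerExpansion g) : HasPowerExpansion fun r => f r * g r := fun n => by
  obtain ⟨p, hp⟩ := hf n
  obtain ⟨q, hq⟩ := hg n
  refine ⟨p * q, ?_⟩
  have h1 := hp.mul hg.isBigO_one
  have h2 := (polynomial_isBigO_one p).mul hq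
  simp only [mul_one, one_mul] at h1 h2
  refine (h1.add h2).congr_left fun r => ?_
  simp; ring

theorem hasPowerExpansion_polynomial (p : Polynomial ℝ) : HasPowerExpansion fun r => p.eval r :=
  fun n => ⟨p, by simpa using isBigO_zero _ _⟩

theorem hasPowerExpansion_const (c : ℝ) : HasPowerExpansion fun _ => c := by
  simpa using hasPowerExpansion_polynomial (Polynomial.C c)

theorem HasPowerExpansion.const_mul {f : ℝ → ℝ} (hf : HasPowerExpansion f) (c : ℝ) :
    HasPowerExpansion fun r => c * f r := (hasPowerExpansion_const c).mul hf

theorem HasPowerExpansion.sub {f g : ℝ → ℝ} (hf : HasPowerExpansion f)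
    (hg : HasPowerExpansion g) : HasPowerExpansion fun r => f r - g r := by
  simpa [sub_eq_add_neg] using hf.add (hg.const_mul (-1))

theorem HasPowerExpansion.congr {f g : ℝ → ℝ} (hf : HasPowerExpansion f)
    (h : f =ᶠ[𝓝[>] 0] g) : HasPowerExpansion g := fun n => by
  obtain ⟨p, hp⟩ := hf n
  exact ⟨p, hp.congr' (h.mono fun r hr => by simp [hr]) EventuallyEq.rfl⟩

theorem HasPowerExpansion.polynomial_comp {f : ℝ → ℝ} (hf : HasPowerExpansion f)
    (p : Polynomial ℝ) : HasPowerExpansion fun r => p.eval (f r) := by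
  induction p using Polynomial.induction_on' with
  | add p q hp hq => simpa using hp.add hq
  | monomial n a =>
    induction n with
    | zero => simpa using hasPowerExpansion_const a
    | succ n ih =>
      refine (ih.mul hf).congr (Eventually.of_forall fun r => ?_)
      simp [pow_succ, mul_assoc]

/-- The Taylor polynomial of `f` at `x₀`, in the variable `x - x₀`. -/
noncomputable def taylorPoly (f : ℝ → ℝ) (n : ℕ) (x₀ : ℝ) : Polynomial ℝ :=
  ∑ k ∈ Finset.range (n + 1), Polynomial.monomial k (iteratedDeriv k f x₀ / k.factorial)

theorem taylor_isBigO {f : ℝ → ℝ} {x₀ : ℝ} (hf : ContDiffAt ℝ ∞ f x₀) (n : ℕ) :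
    (fun x => f x - (taylorPoly f n x₀).eval (x - x₀)) =O[𝓝 x₀] fun x => (x - x₀) ^ n := by
  obtain ⟨u, hu, hfu⟩ := hf.contDiffOn (m := n) (by exact_mod_cast le_top) (by simp)
  obtain ⟨ε, hε, hεu⟩ := Metric.mem_nhds_iff.1 hu
  have h := taylor_isLittleO (convex_ball x₀ ε) (Metric.mem_ball_self hε) (hfu.mono hεu)
  rw [Metric.isOpen_ball.nhdsWithin_eq (Metric.mem_ball_self hε)] at h
  refine h.isBigO.congr_left fun x => ?_
  rw [taylor_within_apply, taylorPoly, Polynomial.eval_finsetSum]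
  congr 1
  refine Finset.sum_congr rfl fun k _ => ?_
  rw [iteratedDerivWithin_of_isOpen Metric.isOpen_ball (Metric.mem_ball_self hε)]
  simp; ring

theorem ContDiffAt.hasPowerExpansion {f : ℝ → ℝ} (hf : ContDiffAt ℝ ∞ f 0) :
    HasPowerExpansion f := fun n =>
  ⟨taylorPoly f n 0, by simpa using (taylor_isBigO hf n).mono nhdsWithin_le_nhds⟩

/-- The approximating polynomials of different orders are not assumed compatible, but each of
positive order has constant term `lim f`. Subtracting this limit and dividing by `r` costs one order
of approximation. -/
theorem HasPowerExpansion.exists_eq_mul {f : ℝ → ℝ} (hf : HasPowerExpansion f) :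
    ∃ a : ℝ, ∃ g : ℝ → ℝ, HasPowerExpansion g ∧ ∀ r, 0 < r → f r = a + r * g r := by
  obtain ⟨p₁, hp₁⟩ := hf 1
  have hlim {p : Polynomial ℝ} {n : ℕ} (hn : n ≠ 0)
      (hp : (fun r => f r - p.eval r) =O[𝓝[>] 0] fun r => r ^ n) :
      Tendsto f (𝓝[>] 0) (𝓝 (p.coeff 0)) := by
    have h1 : Tendsto (fun r : ℝ => r ^ n) (𝓝[>] 0) (𝓝 0) := by
      have : Continuous fun r : ℝ => r ^ n := by fun_prop
      simpa [hn] using (this.tendsto 0).mono_left (nhdsWithin_le_nhds (s := Ioi 0))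
    have h2 := hp.trans_tendsto h1
    have h3 := (p.continuous.tendsto 0).mono_left (nhdsWithin_le_nhds (s := Ioi 0))
    have := h2.add h3
    simpa [Polynomial.coeff_zero_eq_eval_zero] using this
  refine ⟨p₁.coeff 0, fun r => (f r - p₁.coeff 0) / r, fun n => ?_, fun r hr => by field_simp; ring⟩
  obtain ⟨p, hp⟩ := hf (n + 1)
  have e : p.coeff 0 = p₁.coeff 0 :=
    tendsto_nhds_unique (hlim (by simp) hp) (hlim one_ne_zero hp₁)
  refine ⟨p.divX, ?_⟩
  have h := hp.mul (isBigO_refl (fun r : ℝ => r⁻¹) (𝓝[>] 0))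
  refine h.congr' ?_ ?_
  · filter_upwards [self_mem_nhdsWithin] with r (hr : 0 < r)
    conv_lhs => rw [← p.X_mul_divX_add]
    simp [e]; field_simp; ring
  · filter_upwards [self_mem_nhdsWithin] with r (hr : 0 < r)
    field_simp
    ring

theorem HasPowerExpansion.tendsto {f g : ℝ → ℝ} {a : ℝ} (hg : HasPowerExpansion g)
    (h : ∀ r, 0 < r → f r = a + r * g r) : Tendsto f (𝓝[>] 0) (𝓝 a) := by
  have h0 : Tendsto (fun r : ℝ => r) (𝓝[>] 0) (𝓝 0) :=
    tendsto_id.mono_left nhdsWithin_le_nhds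
  have h1 : Tendsto (fun r => r * g r) (𝓝[>] 0) (𝓝 0) := by
    have := (isBigO_refl (fun r : ℝ => r) (𝓝[>] 0)).mul hg.isBigO_one
    simp only [mul_one] at this
    exact this.trans_tendsto h0
  refine (by simpa using h1.const_add a : Tendsto (fun r => a + r * g r) _ (𝓝 a)).congr' ?_
  filter_upwards [self_mem_nhdsWithin] with r hr using (h r hr).symm

/-- Composition of an asymptotic expansion with a smooth function. -/
theorem HasPowerExpansion.comp {φ f : ℝ → ℝ} {a : ℝ} (hf : HasPowerExpansion f)
    (ha : Tendsto f (𝓝[>] 0) (𝓝 a)) (hφ : ContDiffAt ℝ ∞ φ a) :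
    HasPowerExpansion fun r => φ (f r) := fun n => by
  obtain ⟨a', g, hg, hfg⟩ := hf.exists_eq_mul
  obtain rfl : a' = a := tendsto_nhds_unique (hg.tendsto hfg) ha
  -- A Taylor polynomial of `φ` at the limit of `f` is enough: since `f r - a' = O(r)`, its
  -- remainder becomes `O(rⁿ)`.
  have h1 := (taylor_isBigO hφ n).comp_tendsto ha
  have h2 : (fun r => f r - a') =O[𝓝[>] 0] fun r => r := by
    have := (isBigO_refl (fun r : ℝ => r) (𝓝[>] 0)).mul hg.isBigO_one
    simp only [mul_one] at this
    refine this.congr' ?_ EventuallyEq.rfl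
    filter_upwards [self_mem_nhdsWithin] with r hr
    rw [hfg r hr]; ring
  obtain ⟨p, hp⟩ := (hf.sub (hasPowerExpansion_const a')).polynomial_comp (taylorPoly φ n a') n
  refine ⟨p, ((h1.trans (h2.pow n)).add hp).congr_left fun r => ?_⟩
  simp

/-- If `s` and `s log r` both have expansions in powers of `r`, then `s` is flat. -/
theorem isFlat_of_mul_log {s t : ℝ → ℝ} (hs : HasPowerExpansion s) (ht : HasPowerExpansion t)
    (h : ∀ᶠ r in 𝓝[>] 0, s r * Real.log r = t r) : IsFlat s := by
  intro n
  induction n generalizing s t with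
  | zero => simpa using hs.isBigO_one
  | succ n ih =>
    obtain ⟨a, s₁, hs₁, hs⟩ := hs.exists_eq_mul
    obtain ⟨b, t₁, ht₁, ht⟩ := ht.exists_eq_mul
    have hinv : Tendsto (fun r => (Real.log r)⁻¹) (𝓝[>] 0) (𝓝 0) :=
      tendsto_inv_atBot_zero.comp Real.tendsto_log_nhdsGT_zero
    -- Here `s = t / log r`, where `t` has a finite limit and `1 / log r → 0`.
    have ha : a = 0 := by
      have h1 := (ht₁.tendsto ht).mul hinv
      rw [mul_zero] at h1
      refine tendsto_nhds_unique ((hs₁.tendsto hs).congr' ?_) h1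
      filter_upwards [h, self_mem_nhdsWithin, Real.tendsto_log_nhdsGT_zero.eventually_lt_atBot 0]
        with r hr _ hl
      rw [← hr, mul_inv_cancel_right₀ hl.ne]
    subst ha
    -- With `a = 0`, `t = s₁ · (r log r)` is a bounded function times one tending to `0`. Both sides
    -- can then be divided by `r`, and the induction hypothesis applies to `s₁` and `t₁`.
    have hb : b = 0 := by
      have h1 : Tendsto (fun r => Real.log r * r) (𝓝[>] 0) (𝓝 0) := by
        simpa using tendsto_log_mul_rpow_nhdsGT_zero (zero_lt_one)
      have h2 : Tendsto (fun r => s₁ r * (Real.log r * r)) (𝓝[>] 0) (𝓝 0) := by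
        have := hs₁.isBigO_one.mul (isBigO_refl (fun r => Real.log r * r) (𝓝[>] 0))
        simp only [one_mul] at this
        exact this.trans_tendsto h1
      refine tendsto_nhds_unique ((ht₁.tendsto ht).congr' ?_) h2
      filter_upwards [h, self_mem_nhdsWithin] with r hr hr0
      rw [← hr, hs r hr0]; ring
    subst hb
    have h1 := ih hs₁ ht₁ (by
      filter_upwards [h, self_mem_nhdsWithin] with r hr (hr0 : 0 < r)
      rw [hs r hr0, ht r hr0] at hr
      have : r * (s₁ r * Real.log r) = r * t₁ r := by linarith
      exact mul_left_cancel₀ hr0.ne' this)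
    have h2 := (isBigO_refl (fun r : ℝ => r) (𝓝[>] 0)).mul h1
    refine h2.congr' ?_ (Eventually.of_forall fun r => by simp [pow_succ, mul_comm])
    filter_upwards [self_mem_nhdsWithin] with r hr0
    rw [hs r hr0]; ring

theorem IsFlat.add {f g : ℝ → ℝ} (hf : IsFlat f) (hg : IsFlat g) : IsFlat fun r => f r + g r :=
  fun n => (hf n).add (hg n)

theorem IsFlat.trans_isBigO {f g : ℝ → ℝ} (hg : IsFlat g) (h : f =O[𝓝[>] 0] g) : IsFlat f :=
  fun n => h.trans (hg n)

theorem IsFlat.congr {f g : ℝ → ℝ} (hf : IsFlat f) (h : f =ᶠ[𝓝[>] 0] g) : IsFlat g :=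
  fun n => (hf n).congr' h EventuallyEq.rfl

theorem IsFlat.const_mul {f : ℝ → ℝ} (hf : IsFlat f) (c : ℝ) : IsFlat fun r => c * f r :=
  fun n => (hf n).const_mul_left c

/-- Division of a flat function by `r`. -/
theorem IsFlat.of_mul {f : ℝ → ℝ} (hf : IsFlat fun r => r * f r) : IsFlat f := fun n => by
  refine ((hf (n + 1)).mul (isBigO_refl (fun r : ℝ => r⁻¹) (𝓝[>] 0))).congr' ?_ ?_
  · filter_upwards [self_mem_nhdsWithin] with r (hr : 0 < r)
    field_simp
  · filter_upwards [self_mem_nhdsWithin] with r (hr : 0 < r)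
    field_simp
    ring

/-- The factor `r` absorbs the logarithm, because `r log r → 0`. -/
theorem IsFlat.mul_log {f : ℝ → ℝ} (hf : IsFlat f) : IsFlat fun r => r * f r * Real.log r := by
  refine hf.trans_isBigO ?_
  have h1 : Tendsto (fun r => Real.log r * r) (𝓝[>] 0) (𝓝 0) := by
    simpa using tendsto_log_mul_rpow_nhdsGT_zero (zero_lt_one)
  have h2 := (isBigO_refl f (𝓝[>] 0)).mul (h1.isBigO_one ℝ)
  simp only [mul_one] at h2
  exact h2.congr_left fun r => by ring

theorem polynomial_coeff_eq_zero {p : Polynomial ℝ} {n : ℕ}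
    (hp : (fun r => p.eval r) =O[𝓝[>] 0] fun r => r ^ n) {k : ℕ} (hk : k < n) : p.coeff k = 0 := by
  induction n generalizing p k with
  | zero => omega
  | succ n ih =>
    have h0 : p.coeff 0 = 0 := by
      have h1 : Tendsto (fun r : ℝ => r ^ (n + 1)) (𝓝[>] 0) (𝓝 0) := by
        have : Continuous fun r : ℝ => r ^ (n + 1) := by fun_prop
        simpa using (this.tendsto 0).mono_left (nhdsWithin_le_nhds (s := Ioi 0))
      have h3 := (p.continuous.tendsto 0).mono_left (nhdsWithin_le_nhds (s := Ioi 0))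
      rw [Polynomial.coeff_zero_eq_eval_zero]
      exact tendsto_nhds_unique h3 (hp.trans_tendsto h1)
    cases k with
    | zero => exact h0
    | succ k =>
      rw [← Polynomial.coeff_divX]
      refine ih ?_ (by omega)
      refine (hp.mul (isBigO_refl (fun r : ℝ => r⁻¹) (𝓝[>] 0))).congr' ?_ ?_
      · filter_upwards [self_mem_nhdsWithin] with r (hr : 0 < r)
        conv_lhs => rw [← p.X_mul_divX_add]
        simp [h0]; field_simp
      · filter_upwards [self_mem_nhdsWithin] with r (hr : 0 < r)
        field_simp
        ring

/-- All derivatives at `0` of a smooth flat function vanish. -/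
theorem IsFlat.iteratedDeriv_eq_zero {f : ℝ → ℝ} (hf : IsFlat f) (hs : ContDiffAt ℝ ∞ f 0) (n : ℕ) :
    iteratedDeriv n f 0 = 0 := by
  have h1 : (fun r => f r - (taylorPoly f (n + 1) 0).eval r) =O[𝓝[>] 0] fun r => r ^ (n + 1) := by
    simpa using (taylor_isBigO hs (n + 1)).mono nhdsWithin_le_nhds
  have h2 := polynomial_coeff_eq_zero (p := taylorPoly f (n + 1) 0)
    (((hf (n + 1)).sub h1).congr_left fun r => by ring) (Nat.lt_succ_self n)
  simpa [taylorPoly, Polynomial.coeff_monomial, Nat.factorial_ne_zero] using h2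


/-! ### The logarithmic part of the action -/

theorem arg_eq_arctan {a : ℝ} (ha : 0 < a) (b : ℝ) : Complex.arg ⟨a, b⟩ = Real.arctan (b / a) := by
  have h := Complex.abs_arg_lt_pi_div_two_iff.2 (Or.inl ha : 0 < (⟨a, b⟩ : ℂ).re ∨ _)
  rw [abs_lt] at h
  rw [← Real.arctan_tan h.1 h.2, Complex.tan_arg]

theorem branchLog_of_pos {a : ℝ} (ha : 0 < a) (b : ℝ) :
    branchLog ⟨a, b⟩ = Complex.log ⟨a, b⟩ := by
  have h := Complex.abs_arg_lt_pi_div_two_iff.2 (Or.inl ha : 0 < (⟨a, b⟩ : ℂ).re ∨ _)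
  rw [abs_lt] at h
  have hw : (⟨a, b⟩ : ℂ) ≠ 0 := fun h => ha.ne' (congrArg Complex.re h)
  rw [branchLog, Complex.log_mul Complex.I_ne_zero hw, Complex.log_I]
  · push_cast; ring
  · rw [Complex.arg_I]; constructor <;> linarith

/-- For `a < 0` the chosen argument lies in `(-3π/2, -π/2)` and equals `arg (-w) - π`. This `π`,
divided by `2π`, is the origin of the half-integer shift in the `K₄` action. -/
theorem branchLog_of_neg {a : ℝ} (ha : a < 0) (b : ℝ) :
    branchLog ⟨a, b⟩ = Complex.log ⟨-a, -b⟩ - Real.pi * Complex.I := by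
  have h := Complex.abs_arg_lt_pi_div_two_iff.2
    (Or.inl (neg_pos.2 ha) : 0 < (⟨-a, -b⟩ : ℂ).re ∨ _)
  rw [abs_lt] at h
  have hw : (⟨-a, -b⟩ : ℂ) ≠ 0 := fun h => (neg_pos.2 ha).ne' (congrArg Complex.re h)
  have e : Complex.I * ⟨a, b⟩ = -Complex.I * ⟨-a, -b⟩ := by
    apply Complex.ext <;> simp
  rw [branchLog, e, Complex.log_mul (neg_ne_zero.2 Complex.I_ne_zero) hw, Complex.log_neg_I]
  · push_cast; ring
  · rw [Complex.arg_neg_I]; constructor <;> linarith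

theorem norm_mk_log (a b : ℝ) : Real.log ‖(⟨a, b⟩ : ℂ)‖ = Real.log (a ^ 2 + b ^ 2) / 2 := by
  rw [Complex.norm_def, Real.log_sqrt (Complex.normSq_nonneg _), Complex.normSq_mk, sq, sq]

theorem logAction_of_pos {a : ℝ} (ha : 0 < a) (b : ℝ) : logAction (a, b) =
    (1 / (2 * Real.pi)) * (a * Real.arctan (b / a) + b * (Real.log (a ^ 2 + b ^ 2) / 2) - b) := by
  simp only [logAction, branchLog_of_pos ha, Complex.sub_im, Complex.mul_im, Complex.log_re,
    Complex.log_im, norm_mk_log, arg_eq_arctan ha]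

theorem logAction_of_neg {a : ℝ} (ha : a < 0) (b : ℝ) : logAction (a, b) =
    (1 / (2 * Real.pi)) * (a * Real.arctan (b / a) + b * (Real.log (a ^ 2 + b ^ 2) / 2) - b) -
      a / 2 := by
  have h2 : (Complex.log ⟨-a, -b⟩ - Real.pi * Complex.I).re = Real.log (a ^ 2 + b ^ 2) / 2 := by
    simp [Complex.log_re, norm_mk_log]
  have h3 : (Complex.log ⟨-a, -b⟩ - Real.pi * Complex.I).im = Real.arctan (b / a) - Real.pi := by
    simp [Complex.log_im, arg_eq_arctan (neg_pos.2 ha)]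
  simp only [logAction, branchLog_of_neg ha]
  rw [Complex.sub_im, Complex.mul_im, h2, h3]
  have : Real.pi ≠ 0 := Real.pi_ne_zero
  field_simp
  ring

/-- The smooth expression that agrees with `logAction` up to `a / 2`. -/
noncomputable def logActionAux (c : ℝ × ℝ) : ℝ :=
  (1 / (2 * Real.pi)) *
    (c.1 * Real.arctan (c.2 / c.1) + c.2 * (Real.log (c.1 ^ 2 + c.2 ^ 2) / 2) - c.2)

theorem logAction_eventuallyEq {c : ℝ × ℝ} (hc : c.1 ≠ 0) :
    ∃ e : ℝ, logAction =ᶠ[𝓝 c] fun x => logActionAux x - e * x.1 := by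
  rcases hc.lt_or_gt with h | h
  · refine ⟨1 / 2, ?_⟩
    filter_upwards [(isOpen_lt continuous_fst continuous_const).mem_nhds h] with x hx
    rw [show x = (x.1, x.2) from rfl, logAction_of_neg hx, logActionAux]
    ring
  · refine ⟨0, ?_⟩
    filter_upwards [(isOpen_lt continuous_const continuous_fst).mem_nhds h] with x hx
    rw [show x = (x.1, x.2) from rfl, logAction_of_pos hx, logActionAux]
    ring

theorem sq_add_sq_pos {a : ℝ} (ha : a ≠ 0) (b : ℝ) : 0 < a ^ 2 + b ^ 2 := by positivity

theorem contDiffAt_logAction {c : ℝ × ℝ} (hc : c.1 ≠ 0) : ContDiffAt ℝ ∞ logAction c := by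
  obtain ⟨e, he⟩ := logAction_eventuallyEq hc
  refine ContDiffAt.congr_of_eventuallyEq ?_ he
  have h1 : ContDiffAt ℝ ∞ (fun c : ℝ × ℝ => Real.arctan (c.2 / c.1)) c :=
    (contDiffAt_snd.div contDiffAt_fst hc).arctan
  have h2 : ContDiffAt ℝ ∞ (fun c : ℝ × ℝ => Real.log (c.1 ^ 2 + c.2 ^ 2)) c :=
    ((contDiffAt_fst.pow 2).add (contDiffAt_snd.pow 2)).log (sq_add_sq_pos hc _).ne'
  unfold logActionAux
  exact (contDiffAt_const.mul (((contDiffAt_fst.mul h1).add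
    (contDiffAt_snd.mul (h2.div_const 2))).sub contDiffAt_snd)).sub
      (contDiffAt_const.mul contDiffAt_fst)

/-- As `d (w Log w - w) = Log w dw` and `dw (∂/∂b) = i`, the derivative is `Re (Log w) / 2π = log
|w| / 2π`. -/
theorem fderiv_logAction_snd {c : ℝ × ℝ} (hc : c.1 ≠ 0) :
    fderiv ℝ logAction c (0, 1) = Real.log (c.1 ^ 2 + c.2 ^ 2) / (4 * Real.pi) := by
  obtain ⟨e, he⟩ := logAction_eventuallyEq hc
  have hl : HasDerivAt (fun s : ℝ => (c.1, s)) (0, 1) c.2 :=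
    (hasDerivAt_const _ _).prodMk (hasDerivAt_id _)
  have hd : HasDerivAt (fun s => logAction (c.1, s)) (fderiv ℝ logAction c (0, 1)) c.2 :=
    HasFDerivAt.comp_hasDerivAt (f := fun s : ℝ => (c.1, s)) c.2
      ((contDiffAt_logAction hc).differentiableAt (by simp)).hasFDerivAt hl
  have ha : HasDerivAt (fun s => Real.arctan (s / c.1))
      (1 / (1 + (c.2 / c.1) ^ 2) * (1 / c.1)) c.2 :=
    ((hasDerivAt_id c.2).div_const c.1).arctan
  have hb : HasDerivAt (fun s => Real.log (c.1 ^ 2 + s ^ 2))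
      ((2 * c.2) / (c.1 ^ 2 + c.2 ^ 2)) c.2 := by
    have := ((hasDerivAt_pow 2 c.2).const_add (c.1 ^ 2)).log (sq_add_sq_pos hc _).ne'
    simpa using this
  have hg : HasDerivAt (fun s => logActionAux (c.1, s) - e * c.1) ((1 / (2 * Real.pi)) *
      (c.1 * (1 / (1 + (c.2 / c.1) ^ 2) * (1 / c.1)) +
        (1 * (Real.log (c.1 ^ 2 + c.2 ^ 2) / 2) + c.2 * ((2 * c.2) / (c.1 ^ 2 + c.2 ^ 2) / 2)) - 1))
      c.2 :=
    ((((ha.const_mul c.1).add ((hasDerivAt_id c.2).mul (hb.div_const 2))).sub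
      (hasDerivAt_id c.2)).const_mul _).sub_const _
  have hcont : Tendsto (fun s : ℝ => (c.1, s)) (𝓝 c.2) (𝓝 c) := hl.continuousAt
  rw [hd.unique (hg.congr_of_eventuallyEq (hcont.eventually he))]
  have h0 := sq_add_sq_pos hc c.2
  have : Real.pi ≠ 0 := Real.pi_ne_zero
  have h3 : 1 + (c.2 / c.1) ^ 2 ≠ 0 := by positivity
  have h4 : c.1 * (1 / (1 + (c.2 / c.1) ^ 2) * (1 / c.1)) = c.1 ^ 2 / (c.1 ^ 2 + c.2 ^ 2) := by
    field_simp
  have h5 : c.1 ^ 2 / (c.1 ^ 2 + c.2 ^ 2) = 1 - c.2 ^ 2 / (c.1 ^ 2 + c.2 ^ 2) := by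
    field_simp; ring
  rw [h4, h5]
  ring

/-- The defect of homogeneity comes from `Log (r w) = Log w + log r`. Its coefficient is
proportional to `b`, which is how the logarithm detects the second component of a lattice map. -/
theorem logAction_mul {r a : ℝ} (hr : 0 < r) (ha : a ≠ 0) (b : ℝ) : logAction (r * a, r * b) =
    r * logAction (a, b) + (1 / (2 * Real.pi)) * (r * b) * Real.log r := by
  have h1 : r * b / (r * a) = b / a := mul_div_mul_left _ _ hr.ne'
  have h2 : Real.log ((r * a) ^ 2 + (r * b) ^ 2) = 2 * Real.log r + Real.log (a ^ 2 + b ^ 2) := by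
    rw [show (r * a) ^ 2 + (r * b) ^ 2 = r ^ 2 * (a ^ 2 + b ^ 2) by ring,
      Real.log_mul (by positivity) (sq_add_sq_pos ha b).ne', Real.log_pow]
    push_cast; ring
  rcases ha.lt_or_gt with h | h
  · rw [logAction_of_neg h, logAction_of_neg (mul_neg_of_pos_of_neg hr h), h1, h2]
    ring
  · rw [logAction_of_pos h, logAction_of_pos (mul_pos hr h), h1, h2]
    ring

theorem logAction_one_neg (t : ℝ) : logAction (1, -t) = -logAction (1, t) := by
  simp only [logAction_of_pos one_pos, div_one, Real.arctan_neg, neg_sq]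
  ring

theorem logAction_neg_one (t : ℝ) : logAction (-1, t) = logAction (1, t) + 1 / 2 := by
  rw [logAction_of_pos one_pos, logAction_of_neg (by norm_num : (-1 : ℝ) < 0)]
  simp only [div_one, div_neg, Real.arctan_neg, neg_sq]
  ring

/-- `∂(logAction)/∂b` diverges at the origin. -/
theorem tendsto_log_sq_add_sq : Tendsto (fun c : ℝ × ℝ =>
    Real.log (c.1 ^ 2 + c.2 ^ 2) / (4 * Real.pi)) (𝓝[≠] 0) atBot := by
  refine Tendsto.atBot_div_const (by positivity) (Real.tendsto_log_nhdsGT_zero.comp ?_)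
  refine tendsto_nhdsWithin_iff.2 ⟨?_, ?_⟩
  · have : Continuous fun c : ℝ × ℝ => c.1 ^ 2 + c.2 ^ 2 := by fun_prop
    simpa using (this.tendsto 0).mono_left nhdsWithin_le_nhds
  · filter_upwards [self_mem_nhdsWithin] with c (hc : c ≠ 0)
    have : c.1 ≠ 0 ∨ c.2 ≠ 0 := by
      by_contra! h
      exact hc (Prod.ext h.1 h.2)
    rcases this with h | h
    · exact sq_add_sq_pos h _
    · rw [add_comm]; exact sq_add_sq_pos h _


/-! ### Taylor coefficients and derivatives along rays -/

/-- Smooth functions on `ℝ²`. -/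
def smoothFun : Submodule ℝ (ℝ × ℝ → ℝ) where
  carrier := {f | ContDiff ℝ ∞ f}
  zero_mem' := show ContDiff ℝ ∞ fun _ => 0 from contDiff_const
  add_mem' {f g} (hf : ContDiff ℝ ∞ f) (hg : ContDiff ℝ ∞ g) := hf.add hg
  smul_mem' c f (hf : ContDiff ℝ ∞ f) := show ContDiff ℝ ∞ (c • f) from hf.const_smul c

theorem contDiff_smoothFun (f : smoothFun) : ContDiff ℝ ∞ (f : ℝ × ℝ → ℝ) := f.2

theorem differentiable_smoothFun (f : smoothFun) : Differentiable ℝ (f : ℝ × ℝ → ℝ) :=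
  (contDiff_smoothFun f).differentiable (by simp)

/-- The derivative in the direction `v`. -/
noncomputable def dirDeriv (v : ℝ × ℝ) : Module.End ℝ smoothFun where
  toFun f := ⟨fun x => fderiv ℝ (f : ℝ × ℝ → ℝ) x v,
    ((contDiff_smoothFun f).fderiv_right (m := ∞) (by simp)).clm_apply contDiff_const⟩
  map_add' f g := by
    ext x
    exact congrArg (fun L : ℝ × ℝ →L[ℝ] ℝ => L v)
      (fderiv_add (differentiable_smoothFun f x) (differentiable_smoothFun g x))
  map_smul' c f := by
    ext x
    exact congrArg (fun L : ℝ × ℝ →L[ℝ] ℝ => L v)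
      (fderiv_const_smul (differentiable_smoothFun f x) c)

theorem dirDeriv_apply (v : ℝ × ℝ) (f : smoothFun) (x : ℝ × ℝ) :
    (dirDeriv v f : ℝ × ℝ → ℝ) x = fderiv ℝ (f : ℝ × ℝ → ℝ) x v := rfl

/-- Symmetry of the second derivative. On globally smooth functions the directional derivatives are
honest endomorphisms, so commutation makes the binomial theorem available for their powers. -/
theorem dirDeriv_commute (v w : ℝ × ℝ) : Commute (dirDeriv v) (dirDeriv w) := by
  have key (v w : ℝ × ℝ) (f : smoothFun) (x : ℝ × ℝ) :
      (dirDeriv v (dirDeriv w f) : ℝ × ℝ → ℝ) x = fderiv ℝ (fderiv ℝ (f : ℝ × ℝ → ℝ)) x v w := by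
    have h : DifferentiableAt ℝ (fderiv ℝ (f : ℝ × ℝ → ℝ)) x :=
      ((contDiff_smoothFun f).fderiv_right (m := ∞) (by simp)).differentiable (by simp) x
    rw [dirDeriv_apply]
    have := (h.hasFDerivAt.clm_apply (hasFDerivAt_const w x)).fderiv
    refine (congrArg (fun L : ℝ × ℝ →L[ℝ] ℝ => L v) this).trans ?_
    simp
  ext f x
  change (dirDeriv v (dirDeriv w f) : ℝ × ℝ → ℝ) x = (dirDeriv w (dirDeriv v f) : ℝ × ℝ → ℝ) x
  rw [key, key]
  exact ((contDiff_infty.1 (contDiff_smoothFun f) 2).contDiffAt.isSymmSndFDerivAt (by simp)).eq v w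

theorem dirDeriv_eq (v : ℝ × ℝ) :
    dirDeriv v = v.1 • dirDeriv (1, 0) + v.2 • dirDeriv (0, 1) := by
  ext f x
  change fderiv ℝ (f : ℝ × ℝ → ℝ) x v = v.1 • fderiv ℝ (f : ℝ × ℝ → ℝ) x (1, 0) +
    v.2 • fderiv ℝ (f : ℝ × ℝ → ℝ) x (0, 1)
  rw [← map_smul, ← map_smul, ← map_add]
  simp

theorem iteratedDeriv_ray (f : smoothFun) (v : ℝ × ℝ) (n : ℕ) :
    iteratedDeriv n (fun r : ℝ => (f : ℝ × ℝ → ℝ) (r • v)) =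
      fun r => ((dirDeriv v ^ n) f : ℝ × ℝ → ℝ) (r • v) := by
  induction n with
  | zero => simp
  | succ n ih =>
    rw [iteratedDeriv_succ, ih]
    ext r
    rw [pow_succ']
    have h : HasDerivAt (fun r : ℝ => r • v) v r := by simpa using (hasDerivAt_id r).smul_const v
    exact (HasFDerivAt.comp_hasDerivAt (f := fun r : ℝ => r • v) r
      (differentiable_smoothFun ((dirDeriv v ^ n) f) (r • v)).hasFDerivAt h).deriv

/-- The Taylor coefficient of `a^i b^j`. -/
noncomputable def taylorCoeff (f : ℝ × ℝ → ℝ) (i j : ℕ) : ℝ :=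
  ((fun f : ℝ × ℝ → ℝ => fun x => fderiv ℝ f x (1, 0))^[i]
    ((fun f : ℝ × ℝ → ℝ => fun x => fderiv ℝ f x (0, 1))^[j] f)) 0 /
    (i.factorial * j.factorial : ℝ)

theorem coe_dirDeriv_pow (v : ℝ × ℝ) (n : ℕ) (f : smoothFun) :
    ((dirDeriv v ^ n) f : ℝ × ℝ → ℝ) =
      (fun f : ℝ × ℝ → ℝ => fun x => fderiv ℝ f x v)^[n] f := by
  induction n with
  | zero => rfl
  | succ n ih => rw [pow_succ', Function.iterate_succ_apply', ← ih]; rfl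

/-- The binomial theorem for `(v.1 ∂_a + v.2 ∂_b) ^ n`; the binomial coefficients combine with the
factorials in the Taylor coefficients. -/
theorem iteratedDeriv_ray_eq_sum (f : smoothFun) (v : ℝ × ℝ) (n : ℕ) :
    iteratedDeriv n (fun r : ℝ => (f : ℝ × ℝ → ℝ) (r • v)) 0 =
      n.factorial * ∑ m ∈ Finset.HasAntidiagonal.antidiagonal n,
        v.1 ^ m.1 * v.2 ^ m.2 * taylorCoeff (f : ℝ × ℝ → ℝ) m.1 m.2 := by
  rw [iteratedDeriv_ray, dirDeriv_eq, Commute.add_pow'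
    (((dirDeriv_commute _ _).smul_left _).smul_right _), LinearMap.sum_apply,
    Submodule.coe_sum]
  simp only [zero_smul, Finset.sum_apply, Finset.mul_sum]
  refine Finset.sum_congr rfl fun m hm => ?_
  obtain rfl : m.1 + m.2 = n := Finset.HasAntidiagonal.mem_antidiagonal.1 hm
  rw [smul_pow, smul_pow, smul_mul_smul_comm, taylorCoeff, ← coe_dirDeriv_pow, ← coe_dirDeriv_pow,
    ← Nat.add_choose_mul_factorial_mul_factorial, Nat.choose_symm_add]
  have e : (((m.1 + m.2).choose m.2 • (v.1 ^ m.1 * v.2 ^ m.2) •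
      (dirDeriv (1, 0) ^ m.1 * dirDeriv (0, 1) ^ m.2)) f : ℝ × ℝ → ℝ) 0 =
      (m.1 + m.2).choose m.2 • ((v.1 ^ m.1 * v.2 ^ m.2) *
        ((dirDeriv (1, 0) ^ m.1) ((dirDeriv (0, 1) ^ m.2) f) : ℝ × ℝ → ℝ) 0) := rfl
  rw [e, nsmul_eq_mul]
  have h1 : (m.1.factorial : ℝ) ≠ 0 := by positivity
  have h2 : (m.2.factorial : ℝ) ≠ 0 := by positivity
  push_cast
  field_simp

/-- A function that is smooth at the origin has the germ of a smooth function. -/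
theorem exists_smoothFun_eventuallyEq {f : ℝ × ℝ → ℝ} (hf : ∀ᶠ x in 𝓝 0, ContDiffAt ℝ ∞ f x) :
    ∃ g : smoothFun, (g : ℝ × ℝ → ℝ) =ᶠ[𝓝 0] f := by
  obtain ⟨ε, hε, hfε⟩ := Metric.eventually_nhds_iff_ball.1 hf
  let χ : ContDiffBump (0 : ℝ × ℝ) := ⟨ε / 4, ε / 2, by positivity, by linarith⟩
  refine ⟨⟨fun x => χ x * f x, ?_⟩, ?_⟩
  · change ContDiff ℝ ∞ fun x => χ x * f x
    refine contDiff_iff_contDiffAt.2 fun x => ?_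
    by_cases h1 : x ∈ tsupport χ
    swap
    · refine ContDiffAt.congr_of_eventuallyEq (f := fun _ => (0 : ℝ)) contDiffAt_const ?_
      filter_upwards [notMem_tsupport_iff_eventuallyEq.1 h1] with y hy
      simp [hy]
    refine ContDiffAt.mul χ.contDiff.contDiffAt (hfε x ?_)
    rw [χ.tsupport_eq] at h1
    exact Metric.closedBall_subset_ball (by simp only [χ]; linarith) h1
  · filter_upwards [χ.eventuallyEq_one] with x hx
    simp [hx]

theorem iterate_fderiv_congr {f g : ℝ × ℝ → ℝ} (h : f =ᶠ[𝓝 0] g) (v : ℝ × ℝ) (n : ℕ) :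
    (fun f : ℝ × ℝ → ℝ => fun x => fderiv ℝ f x v)^[n] f =ᶠ[𝓝 0]
      (fun f : ℝ × ℝ → ℝ => fun x => fderiv ℝ f x v)^[n] g := by
  induction n with
  | zero => exact h
  | succ n ih =>
    rw [Function.iterate_succ_apply', Function.iterate_succ_apply']
    exact (ih.fderiv (𝕜 := ℝ)).mono fun x hx => by simp [hx]

theorem taylorCoeff_congr {f g : ℝ × ℝ → ℝ} (h : f =ᶠ[𝓝 0] g) (i j : ℕ) :
    taylorCoeff f i j = taylorCoeff g i j := by
  rw [taylorCoeff, taylorCoeff,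
    (iterate_fderiv_congr (iterate_fderiv_congr h (0, 1) j) (1, 0) i).eq_of_nhds]

/-- The derivatives of `f` along a ray in terms of the Taylor coefficients of `f`. -/
theorem iteratedDeriv_ray_zero {f : ℝ × ℝ → ℝ} (hf : ∀ᶠ x in 𝓝 0, ContDiffAt ℝ ∞ f x)
    (v : ℝ × ℝ) (n : ℕ) :
    iteratedDeriv n (fun r : ℝ => f (r • v)) 0 =
      n.factorial * ∑ m ∈ Finset.HasAntidiagonal.antidiagonal n, v.1 ^ m.1 * v.2 ^ m.2 * taylorCoeff f m.1 m.2 := by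
  obtain ⟨g, hg⟩ := exists_smoothFun_eventuallyEq hf
  have h0 : Tendsto (fun r : ℝ => r • v) (𝓝 0) (𝓝 0) := by
    have : Continuous fun r : ℝ => r • v := by fun_prop
    simpa using this.tendsto 0
  have h1 : (fun r : ℝ => (g : ℝ × ℝ → ℝ) (r • v)) =ᶠ[𝓝 0] fun r => f (r • v) := h0.eventually hg
  rw [← h1.iteratedDeriv_eq n, iteratedDeriv_ray_eq_sum]
  simp only [taylorCoeff_congr hg]

theorem coeff_taylorSeries (f : ℝ × ℝ → ℝ) (n : Fin 2 →₀ ℕ) :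
    MvPowerSeries.coeff n (taylorSeries f) = taylorCoeff f (n 0) (n 1) := rfl


/-! ### Rigidity of maps that preserve the lattices -/

/-- The second generator of the period lattice. -/
noncomputable def periodForm (h : ℝ × ℝ → ℝ) (c : ℝ × ℝ) : ℝ × ℝ →L[ℝ] ℝ :=
  fderiv ℝ logAction c + fderiv ℝ h c

/-- The lattice generated by `da` and the differential of `logAction + h`. -/
noncomputable def modelLattice (h : ℝ × ℝ → ℝ) (c : ℝ × ℝ) : Submodule ℤ (ℝ × ℝ →L[ℝ] ℝ) :=
  Submodule.span ℤ {ContinuousLinearMap.fst ℝ ℝ ℝ, periodForm h c}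

theorem mem_modelLattice {h : ℝ × ℝ → ℝ} {c : ℝ × ℝ} {α : ℝ × ℝ →L[ℝ] ℝ} :
    α ∈ modelLattice h c ↔ ∃ m n : ℤ, ∀ v, α v = m * v.1 + n * periodForm h c v := by
  rw [modelLattice, Submodule.mem_span_pair]
  refine exists_congr fun m => exists_congr fun n => ⟨?_, fun H => ?_⟩
  · rintro rfl v
    simp
  · exact ContinuousLinearMap.ext fun v => by simp [H]

theorem continuousAt_fderiv_apply {h : ℝ × ℝ → ℝ} {c : ℝ × ℝ} (hh : ContDiffAt ℝ ∞ h c) :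
    ContinuousAt (fderiv ℝ h) c := (hh.fderiv_right (m := ∞) (by simp)).continuousAt

theorem continuousAt_periodForm {h : ℝ × ℝ → ℝ} {c : ℝ × ℝ} (hh : ContDiffAt ℝ ∞ h c)
    (hc : c.1 ≠ 0) : ContinuousAt (periodForm h) c :=
  (continuousAt_fderiv_apply (contDiffAt_logAction hc)).add (continuousAt_fderiv_apply hh)

theorem hasFDerivAt_logAction_add {h : ℝ × ℝ → ℝ} {c : ℝ × ℝ} (hh : ContDiffAt ℝ ∞ h c)
    (hc : c.1 ≠ 0) : HasFDerivAt (fun x => logAction x + h x) (periodForm h c) c :=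
  ((contDiffAt_logAction hc).differentiableAt (by simp)).hasFDerivAt.add
    (hh.differentiableAt (by simp)).hasFDerivAt

theorem eventually_lt_abs_periodForm {h : ℝ × ℝ → ℝ} (hh : ContDiffAt ℝ ∞ h 0) (K : ℝ) :
    ∀ᶠ c : ℝ × ℝ in 𝓝 0, c.1 ≠ 0 → K < |periodForm h c (0, 1)| := by
  have h1 : ContinuousAt (fun c => fderiv ℝ h c (0, 1)) 0 :=
    (continuousAt_fderiv_apply hh).clm_apply continuousAt_const
  have h2 := tendsto_log_sq_add_sq.atBot_add (h1.tendsto.mono_left (nhdsWithin_le_nhds (s := {0}ᶜ)))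
  have h3 := (tendsto_abs_atBot_atTop.comp h2).eventually_gt_atTop K
  rw [eventually_nhdsWithin_iff] at h3
  filter_upwards [h3] with c hc hc1
  have := hc fun h0 => hc1 (by simpa using congrArg Prod.fst h0)
  simpa [periodForm, fderiv_logAction_snd hc1] using this

/-- In the lattice, covectors that are small on `∂/∂b` are multiples of `da`. -/
theorem eq_of_mem_modelLattice {h : ℝ × ℝ → ℝ} {c : ℝ × ℝ} {α : ℝ × ℝ →L[ℝ] ℝ} {K : ℝ}
    (hα : α ∈ modelLattice h c) (hK : |α (0, 1)| ≤ K) (hc : K < |periodForm h c (0, 1)|) :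
    ∃ m : ℤ, ∀ v, α v = m * v.1 := by
  obtain ⟨m, n, H⟩ := mem_modelLattice.1 hα
  have hn : n = 0 := by
    by_contra hn
    have h1 : (1 : ℝ) ≤ |(n : ℝ)| := by exact_mod_cast Int.one_le_abs hn
    rw [H] at hK
    simp only [mul_zero, zero_add, abs_mul] at hK
    nlinarith [abs_nonneg (periodForm h c (0, 1))]
  exact ⟨m, fun v => by simp [H v, hn]⟩

theorem dense_fst_ne_zero : Dense {c : ℝ × ℝ | c.1 ≠ 0} :=
  (dense_compl_singleton (0 : ℝ)).preimage isOpenMap_fst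

/-- The complement of the axis `a = 0` is open and dense, and `G` is open, so the image of a small
open set off the axis still contains points off the axis. -/
theorem frequently_fst_ne_zero (G : OpenPartialHomeomorph (ℝ × ℝ) (ℝ × ℝ)) {c : ℝ × ℝ}
    (hc : c ∈ G.source) : ∃ᶠ x in 𝓝 c, x.1 ≠ 0 ∧ (G x).1 ≠ 0 := by
  rw [frequently_iff]
  intro U hU
  obtain ⟨V, hVU, hV, hcV⟩ := mem_nhds_iff.1 (inter_mem hU (G.open_source.mem_nhds hc))
  have hV' : IsOpen (V ∩ {x : ℝ × ℝ | x.1 ≠ 0}) :=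
    hV.inter (isOpen_ne_fun continuous_fst continuous_const)
  have hne : (V ∩ {x : ℝ × ℝ | x.1 ≠ 0}).Nonempty := dense_fst_ne_zero.inter_open_nonempty V hV ⟨c, hcV⟩
  have hO := G.isOpen_image_of_subset_source hV' fun x hx => (hVU hx.1).2
  obtain ⟨-, ⟨x, hx, rfl⟩, hy⟩ := dense_fst_ne_zero.inter_open_nonempty _ hO (hne.image _)
  exact ⟨x, (hVU hx.1).1, hx.2, hy⟩

/-- The lattices are compared only where neither `c` nor `G c` lies on the axis `a = 0`. Such points
are dense, so closed conditions extend across the axis by continuity. -/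
theorem eventually_of_closed_of_fst_ne_zero {G : OpenPartialHomeomorph (ℝ × ℝ) (ℝ × ℝ)}
    (h0 : 0 ∈ G.source) {X : Type*} [TopologicalSpace X] {f : ℝ × ℝ → X}
    (hf : ∀ᶠ c in 𝓝 0, ContinuousAt f c) {S : Set X} (hS : IsClosed S)
    (h : ∀ᶠ c in 𝓝 0, c.1 ≠ 0 → (G c).1 ≠ 0 → f c ∈ S) : ∀ᶠ c in 𝓝 0, f c ∈ S := by
  filter_upwards [hf, h.eventually_nhds, G.open_source.mem_nhds h0] with c hc1 hc2 hc3
  by_contra hcS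
  have h1 : ∀ᶠ x in 𝓝 c, f x ∈ Sᶜ := hc1 (hS.isOpen_compl.mem_nhds hcS)
  obtain ⟨x, ⟨hx1, hx2⟩, hx3, hx4⟩ := ((frequently_fst_ne_zero G hc3).and_eventually
    (h1.and hc2)).exists
  exact hx3 (hx4 hx1 hx2)

/-- A local diffeomorphism of the plane that fixes the origin and intertwines the lattices defined
by `h₁` and `h₂`. -/
structure IsLatticeMap (G : OpenPartialHomeomorph (ℝ × ℝ) (ℝ × ℝ)) (h₁ h₂ : ℝ × ℝ → ℝ) : Prop where
  zero_mem : 0 ∈ G.source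
  map_zero : G 0 = 0
  smooth : ContDiffOn ℝ ∞ G G.source
  symm_smooth : ContDiffOn ℝ ∞ G.symm G.target
  smooth_left : ∀ᶠ c in 𝓝 0, ContDiffAt ℝ ∞ h₁ c
  smooth_right : ∀ᶠ c in 𝓝 0, ContDiffAt ℝ ∞ h₂ c
  mem_iff : ∀ᶠ c in 𝓝 0, c.1 ≠ 0 → (G c).1 ≠ 0 → ∀ α : ℝ × ℝ →L[ℝ] ℝ,
    α ∈ modelLattice h₂ (G c) ↔ α.comp (fderiv ℝ G c) ∈ modelLattice h₁ c

namespace IsLatticeMap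

variable {G : OpenPartialHomeomorph (ℝ × ℝ) (ℝ × ℝ)} {h₁ h₂ : ℝ × ℝ → ℝ}

theorem contDiffAt (H : IsLatticeMap G h₁ h₂) : ∀ᶠ c in 𝓝 0, ContDiffAt ℝ ∞ G c := by
  filter_upwards [G.open_source.mem_nhds H.zero_mem] with c hc
  exact H.smooth.contDiffAt (G.open_source.mem_nhds hc)

theorem zero_mem_target (H : IsLatticeMap G h₁ h₂) : 0 ∈ G.target := by
  simpa [H.map_zero] using G.map_source H.zero_mem

theorem tendsto (H : IsLatticeMap G h₁ h₂) : Tendsto G (𝓝 0) (𝓝 0) := by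
  have := G.continuousAt H.zero_mem
  rwa [ContinuousAt, H.map_zero] at this

theorem fderiv_symm_fderiv (H : IsLatticeMap G h₁ h₂) : ∀ᶠ c in 𝓝 0, ∀ v,
    fderiv ℝ G.symm (G c) (fderiv ℝ G c v) = v := by
  filter_upwards [G.open_source.mem_nhds H.zero_mem] with c hc v
  have h1 := ((H.smooth.contDiffAt (G.open_source.mem_nhds hc)).differentiableAt
    (by simp)).hasFDerivAt
  have h2 := ((H.symm_smooth.contDiffAt (G.open_target.mem_nhds (G.map_source hc))).differentiableAt
    (by simp)).hasFDerivAt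
  have h3 := (h2.comp c h1).congr_of_eventuallyEq (f₁ := id) (by
    filter_upwards [G.open_source.mem_nhds hc] with x hx
    simp [G.left_inv hx])
  exact congrArg (fun L : ℝ × ℝ →L[ℝ] ℝ × ℝ => L v) (h3.unique (hasFDerivAt_id c))

/-- The covector `G^* da` is a period whose coefficients stay bounded, while the second generator
blows up on `∂/∂b`; hence `G^* da` is an integer multiple of `da`. The same holds for the inverse,
and the two integers have product `1`. -/
theorem eventually_fst_fderiv (H : IsLatticeMap G h₁ h₂) : ∀ᶠ c in 𝓝 0, c.1 ≠ 0 → (G c).1 ≠ 0 →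
    ∃ m : ℤ, (m = 1 ∨ m = -1) ∧ ∀ v, (fderiv ℝ G c v).1 = m * v.1 := by
  have b1 : ContinuousAt (fun c => |(fderiv ℝ G c (0, 1)).1|) 0 :=
    (((H.contDiffAt.self_of_nhds.fderiv_right (m := ∞) (by simp)).continuousAt.clm_apply
      continuousAt_const).fst).abs
  have b2 : ContinuousAt (fun c => |(fderiv ℝ G.symm c (0, 1)).1|) 0 :=
    ((((H.symm_smooth.contDiffAt (G.open_target.mem_nhds H.zero_mem_target)).fderiv_right (m := ∞)
      (by simp)).continuousAt.clm_apply continuousAt_const).fst).abs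
  filter_upwards [H.mem_iff, H.fderiv_symm_fderiv,
    b1.eventually_lt_const (lt_add_one _), H.tendsto.eventually (b2.eventually_lt_const (lt_add_one _)),
    eventually_lt_abs_periodForm H.smooth_left.self_of_nhds _,
    H.tendsto.eventually (eventually_lt_abs_periodForm H.smooth_right.self_of_nhds _)]
    with c hL hinv hb1 hb2 hp1 hp2 hc hGc
  obtain ⟨m, hm⟩ := eq_of_mem_modelLattice
    ((hL hc hGc (ContinuousLinearMap.fst ℝ ℝ ℝ)).1 (Submodule.subset_span (by simp))) hb1.le (hp1 hc)
  obtain ⟨k, hk⟩ := eq_of_mem_modelLattice (α := (ContinuousLinearMap.fst ℝ ℝ ℝ).comp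
    (fderiv ℝ G.symm (G c))) ((hL hc hGc _).2 (by
      have e : ((ContinuousLinearMap.fst ℝ ℝ ℝ).comp (fderiv ℝ G.symm (G c))).comp (fderiv ℝ G c) =
        ContinuousLinearMap.fst ℝ ℝ ℝ := ContinuousLinearMap.ext fun v => by simp [hinv]
      rw [e]
      exact Submodule.subset_span (by simp))) hb2.le (hp2 hGc)
  refine ⟨m, ?_, hm⟩
  have h1 := hk (fderiv ℝ G c (1, 0))
  have h2 := hm (1, 0)
  simp only [ContinuousLinearMap.comp_apply, hinv, ContinuousLinearMap.coe_fst'] at h1 h2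
  rw [h2] at h1
  have h3 : k * m = 1 := by
    have : (1 : ℝ) = k * m := by simpa using h1
    exact_mod_cast this.symm
  exact Int.eq_one_or_neg_one_of_mul_eq_one' h3 |>.imp And.right And.right

/-- The first component of a lattice map is `± a`. -/
theorem exists_fst_eq (H : IsLatticeMap G h₁ h₂) : ∃ e : ℤ, (e = 1 ∨ e = -1) ∧
    ∀ᶠ c in 𝓝 0, (G c).1 = e * c.1 ∧ ∀ v, (fderiv ℝ G c v).1 = e * v.1 := by
  let π₁ := ContinuousLinearMap.fst ℝ ℝ ℝ
  let f : ℝ × ℝ → (ℝ × ℝ →L[ℝ] ℝ) := fun c => π₁.comp (fderiv ℝ G c)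
  have hf : ∀ᶠ c in 𝓝 0, ContinuousAt f c := by
    filter_upwards [H.contDiffAt] with c hc
    exact continuousAt_const.clm_comp (hc.fderiv_right (m := ∞) (by simp)).continuousAt
  have hclosed : IsClosed ({π₁, -π₁} : Set (ℝ × ℝ →L[ℝ] ℝ)) := (Set.toFinite _).isClosed
  have hmem : ∀ᶠ c in 𝓝 0, f c ∈ ({π₁, -π₁} : Set (ℝ × ℝ →L[ℝ] ℝ)) := by
    refine eventually_of_closed_of_fst_ne_zero H.zero_mem hf hclosed ?_
    filter_upwards [H.eventually_fst_fderiv] with c hc hc1 hc2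
    obtain ⟨m, rfl | rfl, hm⟩ := hc hc1 hc2
    · exact Or.inl (ContinuousLinearMap.ext fun v => by simp [f, π₁, hm])
    · exact Or.inr (ContinuousLinearMap.ext fun v => by simp [f, π₁, hm])
  have hconst : ∀ᶠ c in 𝓝 0, f c = f 0 := by
    have h0 := hmem.self_of_nhds
    -- A continuous map into a two-point set is locally constant: near the origin it avoids the
    -- value other than `f 0`.
    have : ∀ᶠ c in 𝓝 0, f c ∉ ({π₁, -π₁} \ {f 0} : Set (ℝ × ℝ →L[ℝ] ℝ)) :=
      hf.self_of_nhds (((Set.toFinite _).isClosed.isOpen_compl).mem_nhds (by simp))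
    filter_upwards [hmem, this] with c h1 h2
    by_contra h3
    exact h2 ⟨h1, h3⟩
  obtain ⟨e, he, h0⟩ : ∃ e : ℤ, (e = 1 ∨ e = -1) ∧ f 0 = (e : ℝ) • π₁ := by
    rcases hmem.self_of_nhds with h | h
    · exact ⟨1, Or.inl rfl, by simp [h]⟩
    · exact ⟨-1, Or.inr rfl, by
        rw [mem_singleton_iff.1 h]; ext <;> simp⟩
  refine ⟨e, he, ?_⟩
  obtain ⟨ε, hε, hball⟩ := Metric.eventually_nhds_iff_ball.1 (hconst.and H.contDiffAt)
  filter_upwards [hconst, Metric.ball_mem_nhds 0 hε] with c hc hcε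
  refine ⟨?_, fun v => ?_⟩
  · have hd : ∀ x ∈ Metric.ball (0 : ℝ × ℝ) ε,
        HasFDerivAt (fun x => (G x).1 - e * x.1) (0 : ℝ × ℝ →L[ℝ] ℝ) x := by
      intro x hx
      have h1 := (((hball x hx).2.differentiableAt (by simp)).hasFDerivAt.fst).sub
        ((hasFDerivAt_fst (p := x)).const_mul (e : ℝ))
      refine h1.congr_fderiv ?_
      exact sub_eq_zero.2 ((hball x hx).1.trans h0)
    have := Metric.isOpen_ball.is_const_of_fderiv_eq_zero (𝕜 := ℝ)
      (convex_ball (0 : ℝ × ℝ) ε).isPreconnected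
      (fun x hx => (hd x hx).differentiableAt.differentiableWithinAt)
      (fun x hx => (hd x hx).fderiv) hcε (Metric.mem_ball_self hε)
    simp only [H.map_zero, Prod.fst_zero, mul_zero, sub_zero] at this
    linarith
  · have := congrArg (fun L : ℝ × ℝ →L[ℝ] ℝ => L v) (hc.trans h0)
    simpa [f, π₁] using this

theorem discreteTopology_range_intCast : DiscreteTopology (range ((↑) : ℤ → ℝ)) :=
  (Int.isClosedEmbedding_coe_real.isEmbedding.toHomeomorph.symm).isEmbedding.discreteTopology

theorem exists_int_const {S : Set (ℝ × ℝ)} (hS : IsPreconnected S) {f : ℝ × ℝ → ℝ}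
    (hf : ContinuousOn f S) (h : ∀ x ∈ S, ∃ n : ℤ, f x = n) : ∃ n : ℤ, ∀ x ∈ S, f x = n := by
  have := discreteTopology_range_intCast
  obtain ⟨-, ⟨n, rfl⟩, hn⟩ := hS.eqOn_const_of_mapsTo (T := range ((↑) : ℤ → ℝ))
    (isDiscrete_iff_discreteTopology.2 this) hf
    (fun x hx => (h x hx).imp fun n hn => hn.symm) (range_nonempty _)
  exact ⟨n, hn⟩

/-- On the half-plane `a > 0` a lattice map preserves `logAction + h` up to sign and an affine
function of `a`. -/
theorem exists_action_eq (H : IsLatticeMap G h₁ h₂) {e : ℤ} (he : e = 1 ∨ e = -1)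
    (hfst : ∀ᶠ c in 𝓝 0, (G c).1 = e * c.1 ∧ ∀ v, (fderiv ℝ G c v).1 = e * v.1) :
    ∃ s k : ℤ, (s = 1 ∨ s = -1) ∧ ∃ C : ℝ, ∀ᶠ c in 𝓝 0, 0 < c.1 →
      logAction (G c) + h₂ (G c) = s * (logAction c + h₁ c) + k * c.1 + C := by
  obtain ⟨ε, hε, hball⟩ := Metric.eventually_nhds_iff_ball.1 (hfst.and (H.contDiffAt.and
    (H.smooth_left.and ((H.tendsto.eventually H.smooth_right).and (H.mem_iff.and
      (H.fderiv_symm_fderiv.and (eventually_lt_abs_periodForm H.smooth_left.self_of_nhds 0)))))))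
  set S := Metric.ball (0 : ℝ × ℝ) ε ∩ {c | 0 < c.1}
  have hSopen : IsOpen S := Metric.isOpen_ball.inter (isOpen_lt continuous_const continuous_fst)
  have hSconn : IsPreconnected S := ((convex_ball _ _).inter
    (convex_halfSpace_gt (f := Prod.fst) ⟨fun _ _ => rfl, fun _ _ => rfl⟩ 0)).isPreconnected
  have he0 : (e : ℝ) ≠ 0 := by rcases he with rfl | rfl <;> norm_num
  have hc1 {c} (hc : c ∈ S) : c.1 ≠ 0 := hc.2.ne'
  have hG1 {c} (hc : c ∈ S) : (G c).1 ≠ 0 := by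
    rw [(hball c hc.1).1.1]
    exact mul_ne_zero he0 (hc1 hc)
  have hpt : ∀ c ∈ S, ∃ n k : ℤ, (n = 1 ∨ n = -1) ∧ ∀ v,
      periodForm h₂ (G c) (fderiv ℝ G c v) = k * v.1 + n * periodForm h₁ c v := by
    intro c hc
    obtain ⟨⟨-, hd⟩, -, -, -, hL, hinv, hp⟩ := hball c hc.1
    replace hL := hL (hc1 hc) (hG1 hc)
    obtain ⟨k, n, h1⟩ := mem_modelLattice.1 ((hL (periodForm h₂ (G c))).1
      (Submodule.subset_span (by simp)))
    obtain ⟨k', n', h2⟩ := mem_modelLattice.1 ((hL ((periodForm h₁ c).comp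
      (fderiv ℝ G.symm (G c)))).2 (by
        have e : ((periodForm h₁ c).comp (fderiv ℝ G.symm (G c))).comp (fderiv ℝ G c) =
          periodForm h₁ c := ContinuousLinearMap.ext fun v => by simp [hinv]
        rw [e]
        exact Submodule.subset_span (by simp)))
    refine ⟨n, k, ?_, h1⟩
    have h3 := h2 (fderiv ℝ G c (0, 1))
    have h4 := h1 (0, 1)
    simp only [ContinuousLinearMap.comp_apply, hinv, hd, mul_zero, zero_add] at h3 h4
    rw [h4] at h3
    have h5 : periodForm h₁ c (0, 1) ≠ 0 := abs_pos.1 (hp (hc1 hc))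
    have h6 : n' * n = 1 := by
      have : ((n' * n : ℤ) : ℝ) * periodForm h₁ c (0, 1) = 1 * periodForm h₁ c (0, 1) := by
        push_cast; linarith
      exact_mod_cast mul_right_cancel₀ h5 this
    exact Int.eq_one_or_neg_one_of_mul_eq_one' h6 |>.imp And.right And.right
  have hcont₁ : ContinuousOn (periodForm h₁) S := fun c hc =>
    (continuousAt_periodForm (hball c hc.1).2.2.1 (hc1 hc)).continuousWithinAt
  have hcont₂ : ContinuousOn (fun c => (periodForm h₂ (G c)).comp (fderiv ℝ G c)) S := fun c hc =>
    ((ContinuousAt.comp (f := G) (continuousAt_periodForm (hball c hc.1).2.2.2.1 (hG1 hc))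
      (hball c hc.1).2.1.continuousAt).clm_comp
        ((hball c hc.1).2.1.fderiv_right (m := ∞) (by simp)).continuousAt).continuousWithinAt
  have hne {c} (hc : c ∈ S) : periodForm h₁ c (0, 1) ≠ 0 :=
    abs_pos.1 ((hball c hc.1).2.2.2.2.2.2 (hc1 hc))
  -- Evaluation on `∂/∂b` kills `da`, so this quotient is the integer coefficient of the second
  -- generator. It is continuous on a connected set, hence constant.
  obtain ⟨s, hs⟩ := exists_int_const hSconn (f := fun c => (periodForm h₂ (G c)).comp
      (fderiv ℝ G c) (0, 1) / periodForm h₁ c (0, 1))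
    ((hcont₂.clm_apply continuousOn_const).div (hcont₁.clm_apply continuousOn_const)
      fun c hc => hne hc) (fun c hc => by
        obtain ⟨n, k, -, h⟩ := hpt c hc
        exact ⟨n, by simp [h, hne hc]⟩)
  have hpt' : ∀ c ∈ S, (s = 1 ∨ s = -1) ∧ ∃ k : ℤ, ∀ v,
      periodForm h₂ (G c) (fderiv ℝ G c v) = k * v.1 + s * periodForm h₁ c v := by
    intro c hc
    obtain ⟨n, k, hn, h⟩ := hpt c hc
    have h1 := hs c hc
    simp only [ContinuousLinearMap.comp_apply, h, mul_zero, zero_add,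
      mul_div_cancel_right₀ _ (hne hc)] at h1
    obtain rfl : n = s := by exact_mod_cast h1
    exact ⟨hn, k, h⟩
  obtain ⟨k, hk⟩ := exists_int_const hSconn (f := fun c => (periodForm h₂ (G c)).comp
      (fderiv ℝ G c) (1, 0) - s * periodForm h₁ c (1, 0))
    ((hcont₂.clm_apply continuousOn_const).sub
      (continuousOn_const.mul (hcont₁.clm_apply continuousOn_const))) (fun c hc => by
        obtain ⟨-, k, h⟩ := hpt' c hc
        exact ⟨k, by simp [h]⟩)
  have hx₀ : ((ε / 2, 0) : ℝ × ℝ) ∈ S := by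
    refine ⟨?_, half_pos hε⟩
    simp [Prod.norm_def, abs_of_pos hε, hε]
  refine ⟨s, k, (hpt' _ hx₀).1, ?_⟩
  have hd : ∀ c ∈ S, HasFDerivAt (fun c => logAction (G c) + h₂ (G c) -
      s * (logAction c + h₁ c) - k * c.1) (0 : ℝ × ℝ →L[ℝ] ℝ) c := by
    intro c hc
    have h1 := HasFDerivAt.comp (f := G) c
      (hasFDerivAt_logAction_add (hball c hc.1).2.2.2.1 (hG1 hc))
      ((hball c hc.1).2.1.differentiableAt (by simp)).hasFDerivAt
    have h2 := (hasFDerivAt_logAction_add (hball c hc.1).2.2.1 (hc1 hc)).const_mul (s : ℝ)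
    refine ((h1.sub h2).sub ((hasFDerivAt_fst (p := c)).const_mul (k : ℝ))).congr_fderiv ?_
    obtain ⟨-, k', h⟩ := hpt' c hc
    have h3 := hk c hc
    simp only [ContinuousLinearMap.comp_apply, h, mul_one, add_sub_cancel_right] at h3
    exact ContinuousLinearMap.ext fun v => by simp [h, h3]
  refine ⟨logAction (G (ε / 2, 0)) + h₂ (G (ε / 2, 0)) -
    s * (logAction (ε / 2, 0) + h₁ (ε / 2, 0)) - k * (ε / 2), ?_⟩
  filter_upwards [Metric.ball_mem_nhds 0 hε] with c hc hc0
  have := hSopen.is_const_of_fderiv_eq_zero (𝕜 := ℝ) hSconn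
    (fun x hx => (hd x hx).differentiableAt.differentiableWithinAt)
    (fun x hx => (hd x hx).fderiv) (⟨hc, hc0⟩ : c ∈ S) hx₀
  simp only at this
  linarith

end IsLatticeMap


/-! ### Comparison of Taylor series along rays -/

theorem tendsto_ray (v : ℝ × ℝ) : Tendsto (fun r : ℝ => r • v) (𝓝 0) (𝓝 0) := by
  have : Continuous fun r : ℝ => r • v := by fun_prop
  simpa using this.tendsto 0

theorem contDiffAt_ray {f : ℝ × ℝ → ℝ} (hf : ContDiffAt ℝ ∞ f 0) (v : ℝ × ℝ) :
    ContDiffAt ℝ ∞ (fun r : ℝ => f (r • v)) 0 := by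
  refine ContDiffAt.comp (f := fun r : ℝ => r • v) 0 (by simpa using hf) ?_
  exact contDiffAt_id.smul contDiffAt_const

theorem isBigO_sub_of_contDiffAt {E : Type*} [NormedAddCommGroup E] [NormedSpace ℝ E] {f : E → ℝ}
    {x : E} (hf : ContDiffAt ℝ ∞ f x) {u v : ℝ → E} (hu : Tendsto u (𝓝[>] 0) (𝓝 x))
    (hv : Tendsto v (𝓝[>] 0) (𝓝 x)) :
    (fun r => f (u r) - f (v r)) =O[𝓝[>] 0] fun r => u r - v r :=
  (hf.hasStrictFDerivAt (by simp)).isBigO_sub.comp_tendsto (hu.prodMk_nhds hv)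

namespace IsLatticeMap

variable {G : OpenPartialHomeomorph (ℝ × ℝ) (ℝ × ℝ)} {h₁ h₂ : ℝ × ℝ → ℝ}

/-- The terms in `log r` force the slope of the image of the ray to be `s t` up to a flat error.
Replacing `G (r, r t)` by `r (e, s t)` then changes every term of the action identity by a flat
function, and the logarithms cancel. -/
theorem isFlat_ray (H : IsLatticeMap G h₁ h₂) {e s k : ℤ} {C μ : ℝ} (he : e = 1 ∨ e = -1)
    (hfst : ∀ᶠ c in 𝓝 0, (G c).1 = e * c.1)
    (hact : ∀ᶠ c in 𝓝 0, 0 < c.1 →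
      logAction (G c) + h₂ (G c) = s * (logAction c + h₁ c) + k * c.1 + C) (t : ℝ)
    (hμ : logAction ((e : ℝ), s * t) = s * logAction (1, t) + μ) :
    IsFlat fun r => s * h₁ (r • ((1 : ℝ), t)) - h₂ (r • ((e : ℝ), s * t)) - ((μ - k) * r - C) := by
  have he0 : (e : ℝ) ≠ 0 := by rcases he with rfl | rfl <;> norm_num
  have hray : Tendsto (fun r : ℝ => r • ((1 : ℝ), t)) (𝓝[>] 0) (𝓝 0) :=
    (tendsto_ray _).mono_left nhdsWithin_le_nhds
  obtain ⟨a, g, hg, hG2⟩ := (ContDiffAt.hasPowerExpansion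
    (contDiffAt_ray (f := fun c => (G c).2) H.contDiffAt.self_of_nhds.snd (1, t))).exists_eq_mul
  have hlimG : Tendsto (fun r : ℝ => G (r • ((1 : ℝ), t))) (𝓝[>] 0) (𝓝 0) := H.tendsto.comp hray
  obtain rfl : a = 0 := tendsto_nhds_unique (hg.tendsto hG2)
    ((continuous_snd.tendsto' (0 : ℝ × ℝ) 0 rfl).comp hlimG)
  -- A second division provides the limit `a` of `g`, around which `logAction (e, ·)` is expanded
  -- below.
  obtain ⟨a, g', hg', hgg'⟩ := hg.exists_eq_mul
  have hga : Tendsto g (𝓝[>] 0) (𝓝 a) := hg'.tendsto hgg'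
  have hGray : ∀ᶠ r in 𝓝[>] (0 : ℝ), G (r • ((1 : ℝ), t)) = r • ((e : ℝ), g r) := by
    filter_upwards [hray.eventually hfst, self_mem_nhdsWithin] with r h1 hr
    refine Prod.ext ?_ ?_
    · simpa [mul_comm] using h1
    · simpa using hG2 r hr
  have heq : ∀ᶠ r in 𝓝[>] (0 : ℝ), r * logAction ((e : ℝ), g r) +
      (1 / (2 * Real.pi)) * (r * g r) * Real.log r + h₂ (G (r • ((1 : ℝ), t))) =
      s * (r * logAction (1, t) + (1 / (2 * Real.pi)) * (r * t) * Real.log r +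
        h₁ (r • ((1 : ℝ), t))) + k * r + C := by
    filter_upwards [hray.eventually hact, hGray, self_mem_nhdsWithin] with r h1 h2 (hr : 0 < r)
    have h3 := h1 (by simpa using hr)
    rw [h2] at h3 ⊢
    have e1 := logAction_mul hr he0 (g r)
    have e2 := logAction_mul hr one_ne_zero t
    simp only [Prod.smul_mk, smul_eq_mul] at h3 ⊢
    rw [e1, e2] at h3
    simpa using h3
  have hid : HasPowerExpansion fun r => r := by simpa using hasPowerExpansion_polynomial Polynomial.X
  have hLA : ∀ b : ℝ, ContDiffAt ℝ ∞ (fun y => logAction ((e : ℝ), y)) b := fun b =>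
    ContDiffAt.comp (f := fun y : ℝ => ((e : ℝ), y)) b (contDiffAt_logAction he0)
      (contDiffAt_const.prodMk contDiffAt_id)
  have hh₂ : HasPowerExpansion fun r : ℝ => h₂ (G (r • ((1 : ℝ), t))) :=
    ContDiffAt.hasPowerExpansion (contDiffAt_ray (f := fun c => h₂ (G c))
      (ContDiffAt.comp (f := G) 0 (by rw [H.map_zero]; exact H.smooth_right.self_of_nhds)
        H.contDiffAt.self_of_nhds) _)
  have hh₁ : HasPowerExpansion fun r : ℝ => h₁ (r • ((1 : ℝ), t)) :=
    ContDiffAt.hasPowerExpansion (contDiffAt_ray H.smooth_left.self_of_nhds _)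
  -- All terms of `heq` without `log r` have power expansions, so `r (g r - s t)` and its product
  -- with `log r` both have one.
  have hflat : IsFlat fun r => g r - s * t := by
    refine IsFlat.of_mul (isFlat_of_mul_log (hid.mul (hg.sub (hasPowerExpansion_const _)))
      ((((((hid.mul (hasPowerExpansion_const (logAction (1, t)))).add hh₁).const_mul s).add
        (hid.const_mul k)).add (hasPowerExpansion_const C)).sub
          ((hid.mul (hg.comp hga (hLA a))).add hh₂) |>.const_mul (2 * Real.pi)) ?_)
    filter_upwards [heq] with r hr
    have hπ : Real.pi ≠ 0 := Real.pi_ne_zero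
    have : r * (g r - s * t) * Real.log r = 2 * Real.pi * ((1 / (2 * Real.pi)) * (r * g r) *
      Real.log r - s * ((1 / (2 * Real.pi)) * (r * t) * Real.log r)) := by field_simp
    rw [this]
    congr 1
    linarith
  have hgt : Tendsto g (𝓝[>] 0) (𝓝 (s * t)) := by
    have h1 := hflat 1
    have h2 : Tendsto (fun r : ℝ => r ^ 1) (𝓝[>] 0) (𝓝 0) := by
      simp only [pow_one]
      exact tendsto_id.mono_left nhdsWithin_le_nhds
    simpa using (h1.trans_tendsto h2).add_const (s * t)
  have f1 : IsFlat fun r => logAction ((e : ℝ), g r) - logAction ((e : ℝ), s * t) :=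
    hflat.trans_isBigO (isBigO_sub_of_contDiffAt (hLA (s * t)) hgt tendsto_const_nhds)
  have hO (f : ℝ → ℝ) : (fun r => r * f r) =O[𝓝[>] 0] f := by
    have h2 : Tendsto (fun r : ℝ => r) (𝓝[>] 0) (𝓝 0) := tendsto_id.mono_left nhdsWithin_le_nhds
    simpa using (h2.isBigO_one ℝ).mul (isBigO_refl f (𝓝[>] 0))
  have f2 : IsFlat fun r => h₂ (G (r • ((1 : ℝ), t))) - h₂ (r • ((e : ℝ), s * t)) := by
    refine hflat.trans_isBigO ((isBigO_sub_of_contDiffAt H.smooth_right.self_of_nhds hlimG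
      ((tendsto_ray _).mono_left nhdsWithin_le_nhds)).trans (IsBigO.trans ?_ (hO _)))
    refine IsBigO.of_bound 1 ?_
    filter_upwards [hGray] with r hr
    rw [hr, ← smul_sub, Prod.mk_sub_mk, sub_self, norm_smul, Prod.norm_mk]
    simp
  have f3 := (hflat.mul_log).const_mul (1 / (2 * Real.pi))
  refine (((f1.trans_isBigO (hO _)).add f3).add f2).congr ?_
  filter_upwards [heq] with r hr
  rw [hμ]
  linear_combination hr

theorem logAction_sign {e s : ℤ} (he : e = 1 ∨ e = -1) (hs : s = 1 ∨ s = -1) (t : ℝ) :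
    logAction ((e : ℝ), s * t) = s * logAction (1, t) + if e = 1 then 0 else 1 / 2 := by
  rcases he with rfl | rfl <;> rcases hs with rfl | rfl <;>
    simp [logAction_neg_one, logAction_one_neg]

theorem iteratedDeriv_affine (a b : ℝ) (n : ℕ) :
    iteratedDeriv (n + 1) (fun r : ℝ => a * r - b) 0 = if n = 0 then a else 0 := by
  have : deriv (fun r : ℝ => a * r - b) = fun _ => a := by
    ext r
    exact (((hasDerivAt_id r).const_mul a).sub_const b).deriv.trans (mul_one a)
  rw [iteratedDeriv_succ', this, iteratedDeriv_const]

/-- In fixed total degree `n` the exponent `m.2` determines `m`, so the slopes `t` separate the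
monomials of degree `n`. -/
theorem eq_zero_of_forall_sum_antidiagonal {n : ℕ} {c : ℕ × ℕ → ℝ}
    (h : ∀ t : ℝ, ∑ m ∈ Finset.HasAntidiagonal.antidiagonal n, c m * t ^ m.2 = 0) {m : ℕ × ℕ}
    (hm : m.1 + m.2 = n) : c m = 0 := by
  let p : Polynomial ℝ := ∑ m ∈ Finset.HasAntidiagonal.antidiagonal n, Polynomial.monomial m.2 (c m)
  have hp : p = 0 := Polynomial.funext fun t => by simp [p, Polynomial.eval_finsetSum, h]
  have h1 : p.coeff m.2 = 0 := by rw [hp, Polynomial.coeff_zero]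
  simp only [p, Polynomial.finsetSum_coeff, Polynomial.coeff_monomial] at h1
  rw [Finset.sum_eq_single m] at h1
  · simpa using h1
  · intro m' hm' hne
    refine if_neg fun h2 => hne (Prod.ext ?_ h2)
    have := Finset.HasAntidiagonal.mem_antidiagonal.1 hm'
    omega
  · intro h2
    exact absurd (Finset.HasAntidiagonal.mem_antidiagonal.2 hm) h2

/-- The relation between the Taylor coefficients of two functions whose lattices are related by a
lattice map. -/
theorem taylorCoeff_eq (H : IsLatticeMap G h₁ h₂) : ∃ e s k : ℤ, (e = 1 ∨ e = -1) ∧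
    (s = 1 ∨ s = -1) ∧ ∀ i j : ℕ, i + j ≠ 0 → taylorCoeff h₁ i j =
      s * ((e : ℝ) ^ i * (s : ℝ) ^ j) * taylorCoeff h₂ i j +
        if i = 1 ∧ j = 0 then (s : ℝ) * ((if e = 1 then 0 else 1 / 2) - k) else 0 := by
  obtain ⟨e, he, hfst⟩ := H.exists_fst_eq
  obtain ⟨s, k, hs, C, hact⟩ := H.exists_action_eq he hfst
  refine ⟨e, s, k, he, hs, fun i j hij => ?_⟩
  set μ : ℝ := if e = 1 then 0 else 1 / 2
  obtain ⟨n, hn⟩ := Nat.exists_eq_succ_of_ne_zero hij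
  have hss : (s : ℝ) * s = 1 := by rcases hs with rfl | rfl <;> norm_num
  have key : s * taylorCoeff h₁ i j - (e : ℝ) ^ i * (s : ℝ) ^ j * taylorCoeff h₂ i j -
      (if i = 1 ∧ j = 0 then μ - k else 0) = 0 := by
    refine eq_zero_of_forall_sum_antidiagonal (n := n + 1) (m := (i, j)) (c := fun m =>
      s * taylorCoeff h₁ m.1 m.2 - (e : ℝ) ^ m.1 * (s : ℝ) ^ m.2 * taylorCoeff h₂ m.1 m.2 -
        (if m.1 = 1 ∧ m.2 = 0 then μ - k else 0)) (fun t => ?_) hn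
    have s1 : ContDiffAt ℝ ∞ (fun r : ℝ => s * h₁ (r • ((1 : ℝ), t))) 0 :=
      contDiffAt_const.mul (contDiffAt_ray H.smooth_left.self_of_nhds _)
    have s2 : ContDiffAt ℝ ∞ (fun r : ℝ => h₂ (r • ((e : ℝ), s * t))) 0 :=
      contDiffAt_ray H.smooth_right.self_of_nhds _
    have s3 : ContDiffAt ℝ ∞ (fun r : ℝ => (μ - k) * r - C) 0 := by fun_prop
    have hle : ((n + 1 : ℕ) : WithTop ℕ∞) ≤ ∞ := by exact_mod_cast le_top
    have h0 := (H.isFlat_ray he (hfst.mono fun c hc => hc.1) hact t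
      (logAction_sign he hs t)).iteratedDeriv_eq_zero ((s1.sub s2).sub s3) (n + 1)
    rw [iteratedDeriv_fun_sub ((s1.sub s2).of_le hle) (s3.of_le hle),
      iteratedDeriv_fun_sub (s1.of_le hle) (s2.of_le hle), iteratedDeriv_const_mul_field,
      iteratedDeriv_ray_zero H.smooth_left, iteratedDeriv_ray_zero H.smooth_right,
      iteratedDeriv_affine] at h0
    have h1 : (if n = 0 then μ - k else 0) = ((n + 1).factorial : ℝ) *
        ∑ m ∈ Finset.HasAntidiagonal.antidiagonal (n + 1),
          (if m.1 = 1 ∧ m.2 = 0 then μ - k else 0) * t ^ m.2 := by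
      rcases Nat.eq_zero_or_pos n with rfl | hpos
      · simp [Finset.Nat.antidiagonal_succ]
      · rw [if_neg hpos.ne', Finset.sum_eq_zero, mul_zero]
        intro m hm
        have := Finset.HasAntidiagonal.mem_antidiagonal.1 hm
        rw [if_neg (by omega), zero_mul]
    rw [h1] at h0
    have hfac : ((n + 1).factorial : ℝ) ≠ 0 := by positivity
    refine mul_left_cancel₀ hfac ?_
    refine Eq.trans ?_ (h0.trans (mul_zero _).symm)
    rw [Finset.mul_sum, Finset.mul_sum, Finset.mul_sum, Finset.mul_sum,
      Finset.mul_sum, ← Finset.sum_sub_distrib, ← Finset.sum_sub_distrib]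
    refine Finset.sum_congr rfl fun m _ => ?_
    rw [mul_pow]
    ring
  -- The relation `key` is solved for the coefficient of `h₁` by multiplying with `s`, as `s² = 1`.
  split_ifs at key ⊢ <;> linear_combination s * key - taylorCoeff h₁ i j * hss

/-- The Taylor classes of two functions whose lattices are related by a lattice map lie in the same
orbit. -/
theorem exists_star_eq (H : IsLatticeMap G h₁ h₂) :
    ∃ j : K4, star (taylorClass h₂) j = taylorClass h₁ := by
  obtain ⟨e, s, k, he, hs, h⟩ := H.taylorCoeff_eq
  have key (j : K4) (hj1 : sgn j.1 = e) (hj2 : sgn j.2 = s) (m : ℤ)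
      (hm : ((s : ℝ) * ((if e = 1 then 0 else 1 / 2) - k)) = (j.1.val : ℝ) / 2 + m) :
      star (taylorClass h₂) j = taylorClass h₁ := by
    rw [taylorClass, star_mk, taylorClass, QuotientAddGroup.eq]
    -- The quotient absorbs both the discrepancy of the constant terms and the integer part `m` of
    -- the shift in the coefficient of `a`.
    refine ⟨taylorCoeff h₁ 0 0 - s * taylorCoeff h₂ 0 0, m, ?_⟩
    rw [neg_add_eq_iff_eq_add]
    ext n
    have hX : (n = Finsupp.single 0 1) ↔ (n 0 = 1 ∧ n 1 = 0) := by
      constructor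
      · rintro rfl; simp
      · rintro ⟨h1, h2⟩; ext i; fin_cases i <;> simp [h1, h2]
    have h0 : (n = 0) ↔ (n 0 + n 1 = 0) := by
      constructor
      · rintro rfl; simp
      · intro h1; ext i; fin_cases i <;> simp <;> omega
    simp only [map_add, coeff_taylorSeries, coeff_signHom, MvPowerSeries.coeff_C,
      MvPowerSeries.coeff_C_mul, MvPowerSeries.coeff_X, hX, h0, hj1, hj2]
    by_cases hn : n 0 + n 1 = 0
    · have h1 : n 0 = 0 := by omega
      have h2 : n 1 = 0 := by omega
      simp [h1, h2]
    · rw [h _ _ hn]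
      by_cases h1 : n 0 = 1 ∧ n 1 = 0
      · simp only [h1, hm]
        simp
        ring
      · have h2 : ¬(n 0 = 0 ∧ n 1 = 0) := by omega
        simp [h1, h2]
  rcases he with rfl | rfl <;> rcases hs with rfl | rfl
  -- The integers solve `s (μ - k) = j₁ / 2 + m` with `μ = j₁ / 2`. For `e = s = -1` the left side
  -- is `k - 1/2 = 1/2 + (k - 1)`.
  · exact ⟨_, key (0, 0) (by decide) (by decide) (-k) (by simp)⟩
  · exact ⟨_, key (0, 1) (by decide) (by decide) k (by simp)⟩
  · exact ⟨_, key (1, 0) (by decide) (by decide) (-k) (by norm_num [ZMod.val_one]; ring)⟩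
  · exact ⟨_, key (1, 1) (by decide) (by decide) (k - 1) (by norm_num [ZMod.val_one]; ring)⟩

end IsLatticeMap

/-! ### From Eliasson isomorphisms to lattice maps -/

theorem IsRegularizedActionOn.mem_periodLattice_iff {M : Type*} [TopologicalSpace M] [ChartedSpace E4 M]
    {Ω : SymplecticForm M} {D : Set M} {F' : M → ℝ × ℝ} {h : ℝ × ℝ → ℝ}
    (hh : IsRegularizedActionOn Ω D F' h) : (∀ᶠ c in 𝓝 0, ContDiffAt ℝ ∞ h c) ∧
      ∀ᶠ c in 𝓝 0, c.1 ≠ 0 → ∀ α, α ∈ periodLattice Ω D F' c ↔ α ∈ modelLattice h c := by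
  obtain ⟨W, hW, h0, -, hsm, hL, -⟩ := hh
  refine ⟨?_, ?_⟩
  · filter_upwards [hW.mem_nhds h0] with c hc using hsm.contDiffAt (hW.mem_nhds hc)
  · filter_upwards [hW.mem_nhds h0] with c hc hc1 α
    rw [hL c ⟨hc, fun hs => hc1 hs.1⟩]
    rfl

/-- The transition map between two Eliasson isomorphisms intertwines the period lattices. -/
theorem EliassonIso.isLatticeMap {M : Type*} [TopologicalSpace M] [ChartedSpace E4 M]
    {Ω : SymplecticForm M} {F : M → ℝ × ℝ} {p₀ : M} (hF : IsIntegrableSystem Ω F)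
    (E₁ E₂ : EliassonIso Ω F p₀) {h₁ h₂ : ℝ × ℝ → ℝ} (hh₁ : E₁.IsRegularizedAction h₁)
    (hh₂ : E₂.IsRegularizedAction h₂) : IsLatticeMap (E₁.g.symm.trans E₂.g) h₁ h₂ := by
  have hmem (E : EliassonIso Ω F p₀) : F p₀ ∈ E.g.source := by
    rw [E.g_source]; exact mem_image_of_mem F E.mem_source
  have hmem0 (E : EliassonIso Ω F p₀) : 0 ∈ E.g.target := by
    rw [← E.g_value]; exact E.g.map_source (hmem E)
  have hsymm (E : EliassonIso Ω F p₀) : E.g.symm 0 = F p₀ := by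
    rw [← E.g_value]; exact E.g.left_inv (hmem E)
  obtain ⟨hs₁, hL₁⟩ := hh₁.mem_periodLattice_iff
  obtain ⟨hs₂, hL₂⟩ := hh₂.mem_periodLattice_iff
  have h0 : 0 ∈ (E₁.g.symm.trans E₂.g).source := by
    simpa [hsymm] using ⟨hmem0 E₁, hmem E₂⟩
  have hG0 : (E₁.g.symm.trans E₂.g) 0 = 0 := by simp [hsymm, E₂.g_value]
  refine ⟨h0, hG0, ?_, ?_, hs₁, hs₂, ?_⟩
  · exact E₂.g_smooth.comp (E₁.g_symm_smooth.mono fun x hx => hx.1) fun x hx => hx.2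
  · exact E₁.g_smooth.comp (E₂.g_symm_smooth.mono fun x hx => hx.1) fun x hx => hx.2
  · have hlim : Tendsto (E₁.g.symm.trans E₂.g) (𝓝 0) (𝓝 0) := by
      have := (E₁.g.symm.trans E₂.g).continuousAt h0
      rwa [ContinuousAt, hG0] at this
    filter_upwards [hL₁, hlim.eventually hL₂, (E₁.g.symm.trans E₂.g).open_source.mem_nhds h0]
      with c hc₁ hc₂ hc hc1 hGc1 α
    have hcS : E₁.g.symm c ∈ E₁.g.source := E₁.g.map_target hc.1
    have hcS₂ : E₁.g.symm c ∈ E₂.g.source := hc.2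
    have e₁ : E₁.g (E₁.g.symm c) = c := E₁.g.right_inv hc.1
    rw [← hc₁ hc1, ← hc₂ hGc1]
    have i₁ := E₁.mem_periodLattice_iff hF hcS (α.comp (fderiv ℝ (E₁.g.symm.trans E₂.g) c))
    have i₂ := E₂.mem_periodLattice_iff hF hcS₂ α
    rw [e₁] at i₁
    rw [i₁]
    refine i₂.trans ?_
    have hd : DifferentiableAt ℝ (E₁.g.symm.trans E₂.g) (E₁.g (E₁.g.symm c)) := by
      rw [e₁]
      exact ((E₂.g_smooth.comp (E₁.g_symm_smooth.mono fun x hx => hx.1) fun x hx =>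
        hx.2).contDiffAt ((E₁.g.symm.trans E₂.g).open_source.mem_nhds hc)).differentiableAt (by simp)
    have hd₁ := (E₁.g_smooth.contDiffAt (E₁.g.open_source.mem_nhds hcS)).differentiableAt
      (by simp)
    -- The chain rule for `G ∘ E₁.g = E₂.g` near `E₁.g.symm c` turns both membership conditions into
    -- the same covector at that point.
    have hcomp := (hd.hasFDerivAt.comp _ hd₁.hasFDerivAt).congr_of_eventuallyEq (f₁ := E₂.g) (by
      filter_upwards [E₁.g.open_source.mem_nhds hcS] with x hx
      simp [E₁.g.left_inv hx])
    rw [hcomp.fderiv, e₁]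
    rfl

end FocusFocus

theorem mainTheorem2 {M : Type*} [TopologicalSpace M] [T2Space M] [SecondCountableTopology M]
    [ChartedSpace FocusFocus.E4 M] [IsManifold (𝓡 4) ∞ M]
    (Ω : FocusFocus.SymplecticForm M) (F : M → ℝ × ℝ) (p₀ : M)
    (hF : FocusFocus.IsFocusFocusNeighborhood Ω F p₀)
    (E₁ E₂ : FocusFocus.EliassonIso Ω F p₀) (h₁ h₂ : ℝ × ℝ → ℝ)
    (hh₁ : E₁.IsRegularizedAction h₁) (hh₂ : E₂.IsRegularizedAction h₂) :
    FocusFocus.orbit (FocusFocus.taylorClass h₁) =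
      FocusFocus.orbit (FocusFocus.taylorClass h₂) := by
  obtain ⟨j, hj⟩ := (FocusFocus.EliassonIso.isLatticeMap hF.toIsIntegrableSystem E₁ E₂ hh₁
    hh₂).exists_star_eq
  exact AddAction.orbit_eq_iff.2 ⟨j, hj⟩
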